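/- **Notation.** For $x,\omega\in\mathbb R$ and $a>0$ let $T_xg(t)=g(t-x)$, $M_\omega g(t)=e^{2\pi i\omega t}g(t)$, $D_ag(t)=a^{-1/2}g(t/a)$, and let $\mathcal F g(\xi)=\int_{\mathbb R} g(t)e^{-2\pi i t\xi}\,dt$, extended to $\mathcal S'(\mathbb R)$. Let $\alpha\in[0,1]$. An *$\alpha$-covering* is a countable set $\mathcal I$ of intervals $I\subset\mathbb R$ with $\bigcup_{I\in\mathcal I}I=\mathbb R$, such that every $x\in\mathbb R$ lies in at most two of the intervals, and $|I|\asymp(1+|\xi|)^\alpha$ uniformly for all $I\in\mathcal I$ and $\xi\in I$. A *bounded admissible partition of unity* (BAPU) for $\mathcal I$ is a family $(\psi_I)_{I\in\mathcal I}$ in $\mathcal S(\mathbb R)$ with $\sup_I\|\mathcal F^{-1}\psi_I\|_{L^1}<\infty$, $\operatorname{supp}\psi_I\subset I$ and $\sum_{I}\psi_I=1$ on $\mathbb R$. Given an $\alpha$-covering $\mathcal I$, a BAPU $(\psi_I)$ and points $\omega_I\in I$, for $\sigma\in\mathbb R$ and $1\le p,q\le\infty$ the *$\alpha$-modulation space*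 $M^{\sigma,\alpha}_{p,q}(\mathbb R)$ is the set of $f\in\mathcal S'(\mathbb R)$ with $$\|f\|_{M^{\sigma,\alpha}_{p,q}}:=\Big(\sum_{I\in\mathcal I}\big\|\mathcal F^{-1}(\psi_I\,\mathcal F f)\big\|_{L^p}^q\,(1+|\omega_I|)^{\sigma q}\Big)^{1/q}<\infty ,$$ with the supremum over $I$ in place of the $\ell^q$ norm if $q=\infty$; the $L^p$ norm of a distribution not represented by a function in $L^p$ is $\infty$. For $c>0$, $g\in\mathcal S(\mathbb R)$ and $f\in\mathcal S'(\mathbb R)$ the *$\alpha$-transform* (flexible Gabor-wavelet transform) is $$V_g^\alpha f(x,\omega)=\big\langle f,\;T_xM_\omega D_{c(1+|\omega|)^{-\alpha}}g\big\rangle,\qquad x,\omega\in\mathbb R,$$ where $\langle\cdot,\cdot\rangle$ is antilinear in the second argument and extends the $L^2$ inner product. **Theorem.** Let $s\in\mathbb R$, $\alpha\in[0,1]$, $c>0$ and $1\le p,q\le\infty$ (with $1/\infty=0$). Then there is a band-limited $g\in\mathcal S(\mathbb R)\setminus\{0\}$ (that is, $\mathcal F g$ has compact support) such that, for every $\alpha$-covering,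 every BAPU for it and every choice of points $\omega_I\in I$ defining $M^{s+\alpha(1/q-1/2),\alpha}_{p,q}(\mathbb R)$, $$M^{s+\alpha(1/q-1/2),\alpha}_{p,q}(\mathbb R)=\big\{f\in\mathcal S'(\mathbb R):\;V_g^\alpha f\in L^{p,q}_m(\mathbb R^2)\big\},\qquad m(x,\omega)=(1+|\omega|)^s,$$ and there are constants $A,B>0$, not depending on $f$, such that for all $f$ in this space $$A\,\|V_g^\alpha f\|_{L^{p,q}_m}\le\|f\|_{M^{s+\alpha(1/q-1/2),\alpha}_{p,q}}\le B\,\|V_g^\alpha f\|_{L^{p,q}_m},$$ where $$\|F\|_{L^{p,q}_m}=\Big(\int_{\mathbb R}\Big(\int_{\mathbb R}|F(x,\omega)|^p\,dx\Big)^{q/p}(1+|\omega|)^{sq}\,d\omega\Big)^{1/q},$$ with the essential supremum in place of the integral in $x$ or in $\omega$ if $p=\infty$ or $q=\infty$. -/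

import Mathlib

open MeasureTheory
open scoped ENNReal NNReal SchwartzMap FourierTransform ComplexConjugate

noncomputable section

namespace AlphaMod

/-! ### Translation, modulation and dilation of Schwartz functions -/

/-- The character `t ↦ e^{2πiωt}` has temperate growth. -/
theorem hasTemperateGrowth_char (ω : ℝ) :
    Function.HasTemperateGrowth (fun t : ℝ => Complex.exp (2 * Real.pi * Complex.I * ω * t)) := by
  have hd : ∀ n : ℕ, iteratedDeriv n
      (fun t : ℝ => Complex.exp (2 * Real.pi * Complex.I * ω * t)) =
      fun t : ℝ => (2 * Real.pi * Complex.I * ω) ^ n *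
        Complex.exp (2 * Real.pi * Complex.I * ω * t) := by
    intro n
    induction n with
    | zero => ext t; simp
    | succ n ih =>
      rw [iteratedDeriv_succ, ih]
      ext t
      have h1 : HasDerivAt (fun t : ℝ => 2 * Real.pi * Complex.I * ω * (t : ℂ))
          (2 * Real.pi * Complex.I * ω) t := by
        simpa using (Complex.ofRealCLM.hasDerivAt (x := t)).const_mul
          (2 * Real.pi * Complex.I * ω : ℂ)
      rw [(h1.cexp.const_mul _).deriv]
      ring
  have hs : ContDiff ℝ (⊤ : ℕ∞)
      (fun t : ℝ => Complex.exp (2 * Real.pi * Complex.I * ω * t)) :=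
    (contDiff_const.mul Complex.ofRealCLM.contDiff).cexp
  refine ⟨hs, fun n => ⟨0, (‖(2 * Real.pi * Complex.I * ω : ℂ)‖) ^ n, fun t => ?_⟩⟩
  rw [norm_iteratedFDeriv_eq_norm_iteratedDeriv, hd]
  have h2 : ‖Complex.exp (2 * Real.pi * Complex.I * ω * t)‖ = 1 := by
    rw [Complex.norm_exp]; simp
  simp only [norm_mul, norm_pow, h2, mul_one, pow_zero]
  exact le_rfl

/-- Translation `(T_x g)(t) = g(t - x)`. -/
def translation (x : ℝ) (g : 𝓢(ℝ, ℂ)) : 𝓢(ℝ, ℂ) :=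
  SchwartzMap.compSubConstCLM ℂ x g

/-- Modulation `(M_ω g)(t) = e^{2πiωt} g(t)`. -/
def modulation (ω : ℝ) (g : 𝓢(ℝ, ℂ)) : 𝓢(ℝ, ℂ) :=
  SchwartzMap.smulLeftCLM ℂ (fun t : ℝ => Complex.exp (2 * Real.pi * Complex.I * ω * t)) g

/-- Dilation `(D_a g)(t) = a^{-1/2} g(t / a)`, for `a > 0`. -/
def dilation (a : ℝ) (ha : 0 < a) (g : 𝓢(ℝ, ℂ)) : 𝓢(ℝ, ℂ) :=
  ((a ^ (-(1 / 2) : ℝ) : ℝ) : ℂ) •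
    SchwartzMap.compCLMOfContinuousLinearEquiv ℂ
      (ContinuousLinearEquiv.unitsEquivAut ℝ (Units.mk0 a⁻¹ (inv_pos.2 ha).ne')) g

/-- Complex conjugation of a Schwartz function. -/
def conjSchwartz (g : 𝓢(ℝ, ℂ)) : 𝓢(ℝ, ℂ) :=
  SchwartzMap.postcompCLM (𝕜 := ℝ) (Complex.conjCLE : ℂ →L[ℝ] ℂ) g

theorem translation_apply (x : ℝ) (g : 𝓢(ℝ, ℂ)) (t : ℝ) : translation x g t = g (t - x) := rfl

theorem modulation_apply (ω : ℝ) (g : 𝓢(ℝ, ℂ)) (t : ℝ) :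
    modulation ω g t = Complex.exp (2 * Real.pi * Complex.I * ω * t) * g t := by
  simp [modulation, SchwartzMap.smulLeftCLM_apply_apply (hasTemperateGrowth_char ω)]

theorem dilation_apply (a : ℝ) (ha : 0 < a) (g : 𝓢(ℝ, ℂ)) (t : ℝ) :
    dilation a ha g t = ((a ^ (-(1 / 2) : ℝ) : ℝ) : ℂ) * g (t / a) := by
  simp [dilation, div_eq_mul_inv]

theorem conjSchwartz_apply (g : 𝓢(ℝ, ℂ)) (t : ℝ) : conjSchwartz g t = conj (g t) := rfl

/-! ### The flexible Gabor-wavelet transform -/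

theorem scale_pos {c : ℝ} (hc : 0 < c) (α ω : ℝ) : 0 < c * (1 + |ω|) ^ (-α) := by positivity

/-- The atom `T_x M_ω D_{c (1 + |ω|)^{-α}} g`. -/
def atom (α c : ℝ) (hc : 0 < c) (g : 𝓢(ℝ, ℂ)) (x ω : ℝ) : 𝓢(ℝ, ℂ) :=
  translation x (modulation ω (dilation (c * (1 + |ω|) ^ (-α)) (scale_pos hc α ω) g))

/-- The α-transform `V_g^α f (x, ω) = ⟨f, T_x M_ω D_{c (1 + |ω|)^{-α}} g⟩` of a tempered
distribution `f`; the pairing is antilinear in the second slot, i.e. `f` is applied to the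
complex conjugate of the atom. -/
def alphaTransform (α c : ℝ) (hc : 0 < c) (g : 𝓢(ℝ, ℂ)) (f : 𝓢'(ℝ, ℂ)) (z : ℝ × ℝ) : ℂ :=
  f (conjSchwartz (atom α c hc g z.1 z.2))

/-- On Schwartz functions the α-transform is the integral of `f` against the conjugate atom. -/
theorem alphaTransform_schwartz (α c : ℝ) (hc : 0 < c) (g f : 𝓢(ℝ, ℂ)) (z : ℝ × ℝ) :
    alphaTransform α c hc g (f : 𝓢'(ℝ, ℂ)) z = ∫ t, f t * conj (atom α c hc g z.1 z.2 t) := by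
  simp [alphaTransform, conjSchwartz_apply, mul_comm]

/-- A Schwartz function is band-limited if its Fourier transform has compact support. -/
def IsBandLimited (g : 𝓢(ℝ, ℂ)) : Prop := HasCompactSupport (𝓕 g : 𝓢(ℝ, ℂ))

/-! ### Weighted mixed-norm spaces -/

/-- The norm of `L^{p,q}_m(ℝ²)`: the `L^p` norm of `m F` in the first variable `x`, then the `L^q`
norm in the second variable `ω`. -/
def mixedNorm (p q : ℝ≥0∞) (m : ℝ × ℝ → ℝ) (F : ℝ × ℝ → ℂ) : ℝ≥0∞ :=
  eLpNorm (fun ω : ℝ => eLpNorm (fun x : ℝ => (m (x, ω) : ℂ) * F (x, ω)) p volume) q volume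

/-- Membership in `L^{p,q}_m(ℝ²)`. -/
def MemMixed (p q : ℝ≥0∞) (m : ℝ × ℝ → ℝ) (F : ℝ × ℝ → ℂ) : Prop :=
  AEStronglyMeasurable F volume ∧ mixedNorm p q m F < ∞

/-- The weight `m(x, ω) = (1 + |ω|)^s`. -/
def freqWeight (s : ℝ) (z : ℝ × ℝ) : ℝ := (1 + |z.2|) ^ s

/-! ### α-coverings, partitions of unity and α-modulation spaces -/

/-- An α-covering of `ℝ`: a countable set of intervals that covers `ℝ`, such that every point
lies in at most two of them and `|I| ≍ (1 + |ξ|)^α` uniformly in `I` and in `ξ ∈ I`. -/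
structure IsAlphaCovering (α : ℝ) (𝓘 : Set (Set ℝ)) : Prop where
  countable : 𝓘.Countable
  interval : ∀ I ∈ 𝓘, I.OrdConnected
  covers : ⋃₀ 𝓘 = Set.univ
  overlap : ∀ x : ℝ, {I ∈ 𝓘 | x ∈ I}.encard ≤ 2
  size : ∃ A B : ℝ, 0 < A ∧ 0 < B ∧ ∀ I ∈ 𝓘, ∀ ξ ∈ I,
    ENNReal.ofReal (A * (1 + |ξ|) ^ α) ≤ volume I ∧
      volume I ≤ ENNReal.ofReal (B * (1 + |ξ|) ^ α)

/-- A bounded admissible partition of unity subordinate to `𝓘`, made of Schwartz functions. The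
norm of `𝓕L¹` is the `L¹` norm of the inverse Fourier transform. -/
structure IsBAPU (𝓘 : Set (Set ℝ)) (ψ : 𝓘 → 𝓢(ℝ, ℂ)) : Prop where
  bounded : ∃ C : ℝ≥0, ∀ I : 𝓘, eLpNorm (𝓕⁻ (ψ I) : 𝓢(ℝ, ℂ)) 1 volume ≤ C
  supp : ∀ I : 𝓘, tsupport (ψ I) ⊆ I
  sum_eq_one : ∀ ξ : ℝ, HasSum (fun I : 𝓘 => ψ I ξ) 1

/-- The segmentation operator `P f = 𝓕⁻¹(ψ 𝓕 f)` on tempered distributions. -/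
def segmentation (ψ : 𝓢(ℝ, ℂ)) (f : 𝓢'(ℝ, ℂ)) : 𝓢'(ℝ, ℂ) :=
  𝓕⁻ (TemperedDistribution.smulLeftCLM ℂ ψ (𝓕 f))

/-- The `L^p` norm of a tempered distribution: the `L^p` norm of a function in `L^p` that
represents it, and `∞` if there is none. -/
def distLpNorm (p : ℝ≥0∞) (T : 𝓢'(ℝ, ℂ)) : ℝ≥0∞ :=
  ⨅ (u : ℝ → ℂ) (_ : MemLp u p volume ∧ ∀ φ : 𝓢(ℝ, ℂ), T φ = ∫ x, φ x * u x),
    eLpNorm u p volume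

/-- The `ℓ^q` norm of a family of extended nonnegative numbers. -/
def lqNorm {ι : Type*} (q : ℝ≥0∞) (a : ι → ℝ≥0∞) : ℝ≥0∞ :=
  if q = ∞ then ⨆ i, a i else (∑' i, a i ^ q.toReal) ^ (1 / q.toReal)

/-- The norm of `M_{p,q}^{s,α}(ℝ)`, with respect to a covering `𝓘`, a partition of unity `ψ` and
points `ω I ∈ I`. -/
def modNorm (𝓘 : Set (Set ℝ)) (ψ : 𝓘 → 𝓢(ℝ, ℂ)) (ω : 𝓘 → ℝ) (p q : ℝ≥0∞) (s : ℝ)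
    (f : 𝓢'(ℝ, ℂ)) : ℝ≥0∞ :=
  lqNorm q fun I : 𝓘 => distLpNorm p (segmentation (ψ I) f) * ENNReal.ofReal ((1 + |ω I|) ^ s)

/-- The space `M_{p,q}^{s,α}(ℝ)`; the parameter `α` enters through the α-covering `𝓘`. -/
def modSpace (𝓘 : Set (Set ℝ)) (ψ : 𝓘 → 𝓢(ℝ, ℂ)) (ω : 𝓘 → ℝ) (p q : ℝ≥0∞) (s : ℝ) :
    Set 𝓢'(ℝ, ℂ) :=
  {f | modNorm 𝓘 ψ ω p q s f < ∞}

end AlphaMod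

end

noncomputable section

namespace AlphaMod

open SchwartzMap BoundedContinuousFunction

/-! For fixed `ω` the function `V_g^α f(·, ω)` is itself a frequency segment of `f`: if `𝓕 g` is
real, it is `𝓕⁻¹(Ψ_ω 𝓕 f)` with `Ψ_ω(ξ) = a^{1/2} 𝓕 g(a(ξ - ω))` and `a = c(1+|ω|)^{-α}`
(`alphaTransform_eq_segmentFun`). Take `𝓕 g` to be a cutoff that vanishes for `|ξ| ≥ c/2` and equals
`1` for `|ξ| ≤ c/4`. Then `Ψ_ω` lives at distance at most `(1+|ω|)^α / 2` from `ω`, which is the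
length scale of the covering, and it is the constant `a^{1/2}` on the half as wide ball.

In one direction, `Ψ_ω = ∑ Ψ_ω ψ_I` over the boundedly many `I` close to `ω`, and Young's inequality
bounds `‖V_g^α f(·, ω)‖_p` by the largest of these segments (`exists_segment_bound`). In the other,
a fine partition of unity cuts `ψ_I` into a bounded number of pieces, each inside the flat part of
`Ψ_x` for every `x` in an interval of length comparable to `|I|`. There `Ψ_x` can be divided out, so
the largest piece bounds the segment by `‖V_g^α f(·, x)‖_p` throughout that interval
(`exists_interval_bound`).

Integration in `ω` turns these bounds into a comparison of `L^q` and `ℓ^q` norms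
(`eLpNorm_le_lqNorm`, `lqNorm_le_eLpNorm`), with overlaps counted by
`IsAlphaCovering.exists_card_near_le`. The factor `a^{±1/2}` shifts the weight exponent by `α/2` and
the length `|I|^{1/q}` shifts it by `α/q`, whence `s + α(1/q - 1/2)`. -/

/-! ### Tempered distributions under convolution integrals -/

theorem hasTemperateGrowth_ofReal_pow (k : ℕ) :
    Function.HasTemperateGrowth (fun t : ℝ => (t : ℂ) ^ k) := by
  have : Function.HasTemperateGrowth (fun t : ℝ => (t : ℂ)) :=
    Complex.ofRealCLM.hasTemperateGrowth
  fun_prop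

/-- The map `G ↦ t ^ k * G⁽ⁿ⁾(t)` from Schwartz functions to bounded continuous functions. -/
def weightedDeriv (k n : ℕ) : 𝓢(ℝ, ℂ) →L[ℂ] (ℝ →ᵇ ℂ) :=
  (toBoundedContinuousFunctionCLM ℂ ℝ ℂ).comp
    ((smulLeftCLM ℂ (fun t : ℝ => (t : ℂ) ^ k)).comp (derivCLM ℂ ℂ ^ n))

theorem derivCLM_pow_apply (n : ℕ) (G : 𝓢(ℝ, ℂ)) (t : ℝ) :
    (derivCLM ℂ ℂ ^ n) G t = iteratedDeriv n G t := by
  induction n generalizing G with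
  | zero => simp
  | succ n ih =>
    rw [pow_succ, iteratedDeriv_succ']
    exact ih (derivCLM ℂ ℂ G)

theorem weightedDeriv_apply (k n : ℕ) (G : 𝓢(ℝ, ℂ)) (t : ℝ) :
    weightedDeriv k n G t = (t : ℂ) ^ k * iteratedDeriv n G t := by
  rw [← derivCLM_pow_apply]
  simp [weightedDeriv, smulLeftCLM_apply_apply (hasTemperateGrowth_ofReal_pow k)]

theorem seminorm_le_norm_weightedDeriv (k n : ℕ) (G : 𝓢(ℝ, ℂ)) :
    SchwartzMap.seminorm ℂ k n G ≤ ‖weightedDeriv k n G‖ := by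
  refine seminorm_le_bound' ℂ k n G (norm_nonneg _) fun t => ?_
  have := (weightedDeriv k n G).norm_coe_le_norm t
  rwa [weightedDeriv_apply, norm_mul, norm_pow, Complex.norm_real, Real.norm_eq_abs] at this

/-- A tempered distribution factors through finitely many of the maps `weightedDeriv k n`. -/
theorem exists_factorization (f : 𝓢'(ℝ, ℂ)) :
    ∃ (s : Finset (ℕ × ℕ)) (F : (s → (ℝ →ᵇ ℂ)) →L[ℂ] ℂ),
      ∀ G : 𝓢(ℝ, ℂ), f G = F fun i => weightedDeriv i.1.1 i.1.2 G := by
  obtain ⟨s, C, hC, hf⟩ := Seminorm.bound_of_continuous (schwartz_withSeminorms ℂ ℝ ℂ)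
    ((normSeminorm ℂ ℂ).comp (f : 𝓢(ℝ, ℂ) →ₗ[ℂ] ℂ)) (by
      change Continuous fun G => ‖f G‖
      exact (map_continuous f).norm)
  -- Continuity bounds `f` by finitely many seminorms, and `L` collects functions whose sup norms
  -- dominate them. Hence `f` kills the kernel of `L` and descends to its range.
  let L : 𝓢(ℝ, ℂ) →ₗ[ℂ] (s → (ℝ →ᵇ ℂ)) :=
    LinearMap.pi fun i => (weightedDeriv i.1.1 i.1.2 : 𝓢(ℝ, ℂ) →ₗ[ℂ] (ℝ →ᵇ ℂ))
  have hL : ∀ G, ‖f G‖ ≤ C * ‖L G‖ := by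
    intro G
    refine (hf G).trans ?_
    rw [_root_.smul_apply]
    refine mul_le_mul_of_nonneg_left ?_ C.2
    refine Seminorm.finset_sup_apply_le (norm_nonneg _) fun i hi => ?_
    exact (seminorm_le_norm_weightedDeriv i.1 i.2 G).trans (norm_le_pi_norm (L G) ⟨i, hi⟩)
  have hker : LinearMap.ker L ≤ LinearMap.ker (f : 𝓢(ℝ, ℂ) →ₗ[ℂ] ℂ) := by
    intro G hG
    have h0 : L G = 0 := hG
    have := hL G
    rw [h0, norm_zero, mul_zero] at this
    exact norm_le_zero_iff.1 this
  let φ : LinearMap.range L →ₗ[ℂ] ℂ :=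
    ((LinearMap.ker L).liftQ (f : 𝓢(ℝ, ℂ) →ₗ[ℂ] ℂ) hker).comp
      (L.quotKerEquivRange.symm : LinearMap.range L →ₗ[ℂ] _)
  have hφ : ∀ G, φ ⟨L G, G, rfl⟩ = f G := by
    intro G
    have : L.quotKerEquivRange.symm ⟨L G, G, rfl⟩ = (LinearMap.ker L).mkQ G := by
      rw [LinearEquiv.symm_apply_eq]; rfl
    change (LinearMap.ker L).liftQ _ hker (L.quotKerEquivRange.symm ⟨L G, G, rfl⟩) = _
    rw [this]; rfl
  have hb : ∀ x, ‖φ x‖ ≤ C * ‖x‖ := by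
    rintro ⟨_, G, rfl⟩
    rw [hφ]
    exact hL G
  -- Hahn–Banach: `F` now acts on a Banach space, where Bochner integrals commute with it.
  obtain ⟨F, hF, -⟩ := exists_extension_norm_eq (LinearMap.range L) (φ.mkContinuous C hb)
  refine ⟨s, F, fun G => ?_⟩
  rw [← hφ G]
  exact (hF ⟨L G, G, rfl⟩).symm

theorem iteratedDeriv_translation (n : ℕ) (G : 𝓢(ℝ, ℂ)) (x t : ℝ) :
    iteratedDeriv n (translation x G) t = iteratedDeriv n G (t - x) := by
  have : (translation x G : ℝ → ℂ) = fun t => G (t - x) := rfl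
  rw [this, iteratedDeriv_comp_sub_const]

/-- Weighted pointwise bounds on the derivatives of a Schwartz function. -/
theorem exists_decay_bound (k n : ℕ) (G : 𝓢(ℝ, ℂ)) :
    ∃ C : ℝ, 0 ≤ C ∧ ∀ t, (1 + |t|) ^ k * ‖iteratedDeriv n G t‖ ≤ C := by
  refine ⟨2 ^ k * (Finset.Iic (k, n)).sup (fun m => SchwartzMap.seminorm ℂ m.1 m.2) G,
    by positivity, fun t => ?_⟩
  have := one_add_le_sup_seminorm_apply (𝕜 := ℂ) (m := (k, n)) le_rfl le_rfl G t
  rwa [norm_iteratedFDeriv_eq_norm_iteratedDeriv, Real.norm_eq_abs] at this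

/-- Polynomial growth in `x` is enough for integrability against a Schwartz function; it comes from
`|t| ≤ (1+|t-x|)(1+|x|)`. -/
theorem norm_weightedDeriv_translation_le (k n : ℕ) (G : 𝓢(ℝ, ℂ)) :
    ∃ C : ℝ, 0 ≤ C ∧ ∀ x, ‖weightedDeriv k n (translation x G)‖ ≤ C * (1 + |x|) ^ k := by
  obtain ⟨C, hC, h⟩ := exists_decay_bound k n G
  refine ⟨C, hC, fun x => ?_⟩
  refine (norm_le (by positivity)).2 fun t => ?_
  rw [weightedDeriv_apply, iteratedDeriv_translation, norm_mul, norm_pow, Complex.norm_real,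
    Real.norm_eq_abs]
  have h1 : |t| ≤ (1 + |t - x|) * (1 + |x|) := by
    have : |t| ≤ |t - x| + |x| := by simpa using abs_add_le (t - x) x
    nlinarith [abs_nonneg (t - x), abs_nonneg x, mul_nonneg (abs_nonneg (t - x)) (abs_nonneg x)]
  calc |t| ^ k * ‖iteratedDeriv n G (t - x)‖
      ≤ ((1 + |t - x|) * (1 + |x|)) ^ k * ‖iteratedDeriv n G (t - x)‖ := by gcongr
    _ = ((1 + |t - x|) ^ k * ‖iteratedDeriv n G (t - x)‖) * (1 + |x|) ^ k := by
        rw [mul_pow]; ring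
    _ ≤ C * (1 + |x|) ^ k := by gcongr; exact h _

/-- The mean value inequality in `x`, uniform in `t` thanks to the decay of one more derivative of
`G`, gives a local Lipschitz bound in sup norm. -/
theorem continuous_weightedDeriv_translation (k n : ℕ) (G : 𝓢(ℝ, ℂ)) :
    Continuous fun x => weightedDeriv k n (translation x G) := by
  obtain ⟨C, hC, h⟩ := exists_decay_bound k (n + 1) G
  rw [continuous_iff_continuousAt]
  intro x₀
  have key : ∀ x ∈ Metric.ball x₀ 1, ‖weightedDeriv k n (translation x G) -
      weightedDeriv k n (translation x₀ G)‖ ≤ (C * (2 + |x₀|) ^ k) * |x - x₀| := by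
    intro x hx
    refine (norm_le (by positivity)).2 fun t => ?_
    rw [BoundedContinuousFunction.sub_apply, weightedDeriv_apply, weightedDeriv_apply,
      iteratedDeriv_translation, iteratedDeriv_translation, ← mul_sub]
    have hd : ∀ y ∈ Metric.ball x₀ 1,
        HasDerivWithinAt (fun y => (t : ℂ) ^ k * iteratedDeriv n G (t - y))
          ((t : ℂ) ^ k * -iteratedDeriv (n + 1) G (t - y)) (Metric.ball x₀ 1) y := by
      intro y _
      have h1 : HasDerivAt (iteratedDeriv n G) (iteratedDeriv (n + 1) G (t - y)) (t - y) := by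
        rw [iteratedDeriv_succ]
        refine DifferentiableAt.hasDerivAt ?_
        exact ((G.smooth (⊤ : ℕ∞)).differentiable_iteratedDeriv n
          (by exact_mod_cast WithTop.coe_lt_top n)).differentiableAt
      have h2 : HasDerivAt (fun y => t - y) (-1) y := by
        simpa using (hasDerivAt_id y).const_sub t
      have h3 := HasDerivAt.scomp y h1 h2
      have h4 := (h3.const_mul ((t : ℂ) ^ k)).hasDerivWithinAt (s := Metric.ball x₀ 1)
      simpa [Function.comp_def] using h4
    have := (convex_ball x₀ 1).norm_image_sub_le_of_norm_hasDerivWithin_le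
      (C := C * (2 + |x₀|) ^ k) hd (fun y hy => ?_) (Metric.mem_ball_self one_pos) hx
    · simpa [mul_sub] using this
    · rw [norm_mul, norm_neg, norm_pow, Complex.norm_real, Real.norm_eq_abs]
      have h0 : |y| ≤ 1 + |x₀| := by
        rw [Metric.mem_ball, Real.dist_eq] at hy
        have : |y| ≤ |y - x₀| + |x₀| := by simpa using abs_add_le (y - x₀) x₀
        linarith
      have h1 : |t| ≤ (1 + |t - y|) * (2 + |x₀|) := by
        have : |t| ≤ |t - y| + |y| := by simpa using abs_add_le (t - y) y
        nlinarith [abs_nonneg (t - y), abs_nonneg x₀,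
          mul_nonneg (abs_nonneg (t - y)) (abs_nonneg x₀)]
      calc |t| ^ k * ‖iteratedDeriv (n + 1) G (t - y)‖
          ≤ ((1 + |t - y|) * (2 + |x₀|)) ^ k * ‖iteratedDeriv (n + 1) G (t - y)‖ := by gcongr
        _ = ((1 + |t - y|) ^ k * ‖iteratedDeriv (n + 1) G (t - y)‖) * (2 + |x₀|) ^ k := by
            rw [mul_pow]; ring
        _ ≤ C * (2 + |x₀|) ^ k := by gcongr; exact h _
  rw [ContinuousAt, tendsto_iff_norm_sub_tendsto_zero]
  refine squeeze_zero' (Filter.Eventually.of_forall fun _ => norm_nonneg _)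
    (Filter.mem_of_superset (Metric.ball_mem_nhds x₀ one_pos) key) ?_
  have : Filter.Tendsto (fun x => C * (2 + |x₀|) ^ k * |x - x₀|) (nhds x₀)
      (nhds (C * (2 + |x₀|) ^ k * |x₀ - x₀|)) := by
    apply Continuous.tendsto; fun_prop
  simpa using this

theorem integrable_one_add_pow_mul (k : ℕ) (φ : 𝓢(ℝ, ℂ)) :
    Integrable fun x : ℝ => (1 + |x|) ^ k * ‖φ x‖ := by
  have h1 := (φ.integrable (μ := volume)).norm.const_mul (2 ^ (k - 1) : ℝ)
  have h2 := (φ.integrable_pow_mul volume k).const_mul (2 ^ (k - 1) : ℝ)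
  refine (h1.add h2).mono' ?_ (Filter.Eventually.of_forall fun x => ?_)
  · have := φ.continuous
    exact Continuous.aestronglyMeasurable (by fun_prop)
  · rw [Real.norm_of_nonneg (by positivity)]
    have := add_pow_le zero_le_one (abs_nonneg x) k
    rw [one_pow] at this
    calc (1 + |x|) ^ k * ‖φ x‖ ≤ (2 ^ (k - 1) * (1 + |x| ^ k)) * ‖φ x‖ := by gcongr
      _ = _ := by simp [Real.norm_eq_abs]; ring

/-- The function `x ↦ f(G(· - x))` is continuous. -/
theorem continuous_apply_translation (f : 𝓢'(ℝ, ℂ)) (G : 𝓢(ℝ, ℂ)) :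
    Continuous fun x => f (translation x G) := by
  obtain ⟨s, F, hF⟩ := exists_factorization f
  simp only [hF]
  exact F.continuous.comp (continuous_pi fun i => continuous_weightedDeriv_translation _ _ G)

/-- A tempered distribution may be moved under a convolution integral. -/
theorem apply_eq_integral_translation (f : 𝓢'(ℝ, ℂ)) (φ G Γ : 𝓢(ℝ, ℂ))
    (hΓ : ∀ n t, iteratedDeriv n Γ t = ∫ x, φ x * iteratedDeriv n G (t - x)) :
    Integrable (fun x => φ x * f (translation x G)) ∧
      f Γ = ∫ x, φ x * f (translation x G) := by
  obtain ⟨s, F, hF⟩ := exists_factorization f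
  let u : ℝ → (s → (ℝ →ᵇ ℂ)) := fun x i => weightedDeriv i.1.1 i.1.2 (translation x G)
  have hu : Continuous u := continuous_pi fun i => continuous_weightedDeriv_translation _ _ G
  have hi : ∀ i : s, Integrable fun x => φ x • u x i := by
    intro i
    obtain ⟨C, hC, h⟩ := norm_weightedDeriv_translation_le i.1.1 i.1.2 G
    refine ((integrable_one_add_pow_mul i.1.1 φ).const_mul C).mono'
      (φ.continuous.smul ((continuous_apply i).comp hu)).aestronglyMeasurable
      (Filter.Eventually.of_forall fun x => ?_)
    rw [norm_smul]
    calc ‖φ x‖ * ‖u x i‖ ≤ ‖φ x‖ * (C * (1 + |x|) ^ i.1.1) := by gcongr; exact h x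
      _ = _ := by ring
  have hint : Integrable fun x => φ x • u x := by
    refine Integrable.of_eval (f := fun x => φ x • u x) hi
  have heq : ∀ x, φ x * f (translation x G) = F (φ x • u x) := by
    intro x; rw [map_smul, hF, smul_eq_mul]
  simp only [heq]
  refine ⟨F.integrable_comp hint, ?_⟩
  -- It remains to identify the Bochner integral with the weighted derivatives of `Γ`. Coordinates
  -- and point evaluations are continuous, so this is a scalar identity for each `t`, namely `hΓ`.
  rw [F.integral_comp_comm hint, hF]
  congr 1
  funext i
  have h1 : (∫ x, φ x • u x) i = ∫ x, φ x • u x i :=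
    ((ContinuousLinearMap.proj (R := ℂ) (φ := fun _ : s => (ℝ →ᵇ ℂ)) i).integral_comp_comm
      hint).symm
  rw [h1]
  ext t
  have h2 : (∫ x, φ x • u x i) t = ∫ x, φ x * u x i t :=
    ((BoundedContinuousFunction.evalCLM ℂ t).integral_comp_comm (hi i)).symm
  rw [h2, weightedDeriv_apply, hΓ, ← integral_const_mul]
  congr 1
  funext x
  change _ = φ x * weightedDeriv i.1.1 i.1.2 (translation x G) t
  rw [weightedDeriv_apply, iteratedDeriv_translation]
  ring

/-! ### Segments as continuous functions -/

/-- The pointwise product of two Schwartz functions. -/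
def mulSchwartz (χ ψ : 𝓢(ℝ, ℂ)) : 𝓢(ℝ, ℂ) := smulLeftCLM ℂ χ ψ

theorem mulSchwartz_apply (χ ψ : 𝓢(ℝ, ℂ)) (t : ℝ) : mulSchwartz χ ψ t = χ t * ψ t := by
  simp [mulSchwartz, smulLeftCLM_apply_apply χ.hasTemperateGrowth]

theorem segmentation_apply (ψ φ : 𝓢(ℝ, ℂ)) (f : 𝓢'(ℝ, ℂ)) :
    segmentation ψ f φ = f (𝓕 (mulSchwartz ψ (𝓕⁻ φ))) := rfl

/-- The function `𝓕⁻¹ ψ * f` that represents the distribution `segmentation ψ f`. -/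
def segmentFun (ψ : 𝓢(ℝ, ℂ)) (f : 𝓢'(ℝ, ℂ)) (x : ℝ) : ℂ := f (translation x (𝓕 ψ))

theorem continuous_segmentFun (ψ : 𝓢(ℝ, ℂ)) (f : 𝓢'(ℝ, ℂ)) : Continuous (segmentFun ψ f) :=
  continuous_apply_translation f _

theorem fourier_apply_integral (G : 𝓢(ℝ, ℂ)) (t : ℝ) :
    (𝓕 G : 𝓢(ℝ, ℂ)) t = ∫ ξ : ℝ, Complex.exp (2 * Real.pi * Complex.I * (-t : ℝ) * ξ) * G ξ := by
  rw [fourier_coe, Real.fourier_real_eq_integral_exp_smul]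
  refine integral_congr_ae (Filter.Eventually.of_forall fun ξ => ?_)
  simp only [smul_eq_mul]
  congr 2
  push_cast
  ring

theorem fourierInv_apply_integral (G : 𝓢(ℝ, ℂ)) (t : ℝ) :
    (𝓕⁻ G : 𝓢(ℝ, ℂ)) t = ∫ ξ : ℝ, Complex.exp (2 * Real.pi * Complex.I * t * ξ) * G ξ := by
  rw [fourierInv_coe, Real.fourierInv_eq_fourier_neg, ← fourier_coe, fourier_apply_integral]
  simp

theorem fourierInv_neg_apply (G : 𝓢(ℝ, ℂ)) (t : ℝ) :
    (𝓕⁻ G : 𝓢(ℝ, ℂ)) (-t) = (𝓕 G : 𝓢(ℝ, ℂ)) t := by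
  rw [fourierInv_apply_integral, fourier_apply_integral]

theorem fourierInv_modulation_apply (ω : ℝ) (G : 𝓢(ℝ, ℂ)) (t : ℝ) :
    (𝓕⁻ (modulation ω G) : 𝓢(ℝ, ℂ)) t = (𝓕⁻ G : 𝓢(ℝ, ℂ)) (t + ω) := by
  rw [fourierInv_apply_integral, fourierInv_apply_integral]
  refine integral_congr_ae (Filter.Eventually.of_forall fun ξ => ?_)
  simp only [modulation_apply, ← mul_assoc, ← Complex.exp_add]
  congr 2
  push_cast
  ring

theorem fourier_modulation_apply (ω : ℝ) (G : 𝓢(ℝ, ℂ)) (t : ℝ) :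
    (𝓕 (modulation ω G) : 𝓢(ℝ, ℂ)) t = (𝓕 G : 𝓢(ℝ, ℂ)) (t - ω) := by
  rw [← fourierInv_neg_apply, fourierInv_modulation_apply, ← fourierInv_neg_apply]
  congr 1; ring

/-- The multiplication formula `∫ 𝓕⁻φ · G = ∫ φ · 𝓕⁻G`, with `G` the modulation of `ψ` by `-t`. -/
theorem fourier_mulSchwartz_fourierInv (ψ φ : 𝓢(ℝ, ℂ)) (t : ℝ) :
    (𝓕 (mulSchwartz ψ (𝓕⁻ φ)) : 𝓢(ℝ, ℂ)) t = ∫ x, φ x * (𝓕 ψ : 𝓢(ℝ, ℂ)) (t - x) := by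
  have h := integral_fourierInv_mul_eq φ (modulation (-t) ψ)
  rw [fourier_apply_integral]
  convert h using 2
  · funext ξ
    rw [mulSchwartz_apply, modulation_apply]
    ring
  · funext x
    rw [fourierInv_modulation_apply, ← fourierInv_neg_apply]
    congr 2; ring

theorem derivCLM_fourier (ψ : 𝓢(ℝ, ℂ)) :
    derivCLM ℂ ℂ (𝓕 ψ) =
      𝓕 (-(2 * Real.pi * Complex.I) • smulLeftCLM ℂ (fun t : ℝ => (t : ℂ)) ψ) := by
  have h := lineDerivOp_fourier_eq ψ (1 : ℝ)
  have e1 : derivCLM ℂ ℂ (𝓕 ψ) = LineDeriv.lineDerivOp (1 : ℝ) (𝓕 ψ) := by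
    ext x
    rw [lineDerivOp_apply_eq_fderiv, derivCLM_apply, fderiv_eq_smul_deriv, one_smul]
  rw [e1, h]
  congr 2
  ext t
  have h1 : Function.HasTemperateGrowth (fun t : ℝ => (t : ℂ)) :=
    Complex.ofRealCLM.hasTemperateGrowth
  have h2 : Function.HasTemperateGrowth (fun t : ℝ => inner ℝ t (1 : ℝ)) := by fun_prop
  rw [smulLeftCLM_apply_apply h1, smulLeftCLM_apply_apply h2]
  simp

/-- A derivative of the Fourier transform multiplies the input by `-2πiξ`, and this factor can be
absorbed into `ψ`; hence the induction runs over all `ψ`. It supplies the hypothesis of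
`apply_eq_integral_translation`. -/
theorem iteratedDeriv_fourier_mulSchwartz (φ : 𝓢(ℝ, ℂ)) (n : ℕ) (ψ : 𝓢(ℝ, ℂ)) (t : ℝ) :
    iteratedDeriv n (𝓕 (mulSchwartz ψ (𝓕⁻ φ)) : 𝓢(ℝ, ℂ)) t =
      ∫ x, φ x * iteratedDeriv n (𝓕 ψ : 𝓢(ℝ, ℂ)) (t - x) := by
  induction n generalizing ψ with
  | zero => simpa using fourier_mulSchwartz_fourierInv ψ φ t
  | succ n ih =>
    have h1 : Function.HasTemperateGrowth (fun t : ℝ => (t : ℂ)) :=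
      Complex.ofRealCLM.hasTemperateGrowth
    have e : ∀ G : 𝓢(ℝ, ℂ), deriv (𝓕 G : 𝓢(ℝ, ℂ)) = (𝓕 (-(2 * Real.pi * Complex.I) •
        smulLeftCLM ℂ (fun t : ℝ => (t : ℂ)) G) : 𝓢(ℝ, ℂ)) := by
      intro G; rw [← derivCLM_fourier]; rfl
    rw [iteratedDeriv_succ', iteratedDeriv_succ', e, e, ← ih]
    congr 3
    ext ξ
    simp only [_root_.smul_apply, smulLeftCLM_apply_apply h1, mulSchwartz_apply, smul_eq_mul]
    ring

/-- The segmentation `segmentation ψ f` is represented by the function `segmentFun ψ f`. -/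
theorem segmentation_eq_integral (ψ φ : 𝓢(ℝ, ℂ)) (f : 𝓢'(ℝ, ℂ)) :
    Integrable (fun x => φ x * segmentFun ψ f x) ∧
      segmentation ψ f φ = ∫ x, φ x * segmentFun ψ f x :=
  apply_eq_integral_translation f φ (𝓕 ψ) _ fun n t => iteratedDeriv_fourier_mulSchwartz φ n ψ t

/-- If a distribution is represented by a continuous function, its `L^p` norm is the `L^p` norm of
that function. -/
theorem distLpNorm_eq_of_continuous {p : ℝ≥0∞} (hp : 1 ≤ p) {T : 𝓢'(ℝ, ℂ)} {H : ℝ → ℂ}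
    (hH : Continuous H) (hT : ∀ φ : 𝓢(ℝ, ℂ), T φ = ∫ x, φ x * H x) :
    distLpNorm p T = eLpNorm H p volume := by
  refine le_antisymm ?_ ?_
  · by_cases h : MemLp H p volume
    · exact iInf₂_le H ⟨h, hT⟩
    · have : eLpNorm H p volume = ∞ := by
        by_contra h'
        exact h ⟨hH.aestronglyMeasurable, lt_top_iff_ne_top.2 h'⟩
      rw [this]; exact le_top
  · refine le_iInf₂ fun u hu => ?_
    -- Both functions represent `T`, so they agree against compactly supported smooth functions, and
    -- both are locally integrable.
    have hae : ∀ᵐ x, u x = H x := by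
      refine ae_eq_of_integral_contDiff_smul_eq (hu.1.locallyIntegrable hp)
        hH.locallyIntegrable fun g hg hgc => ?_
      let φ : 𝓢(ℝ, ℂ) := HasCompactSupport.toSchwartzMap (f := fun x => (g x : ℂ))
        (hgc.comp_left (g := fun r : ℝ => (r : ℂ)) (by simp))
        (Complex.ofRealCLM.contDiff.comp hg)
      have := (hu.2 φ).symm.trans (hT φ)
      simp only [Complex.real_smul]
      exact this
    exact (eLpNorm_congr_ae hae).ge

theorem distLpNorm_segmentation {p : ℝ≥0∞} (hp : 1 ≤ p) (ψ : 𝓢(ℝ, ℂ)) (f : 𝓢'(ℝ, ℂ)) :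
    distLpNorm p (segmentation ψ f) = eLpNorm (segmentFun ψ f) p volume :=
  distLpNorm_eq_of_continuous hp (continuous_segmentFun ψ f) fun φ =>
    (segmentation_eq_integral ψ φ f).2

theorem segmentFun_smul (a : ℂ) (ψ : 𝓢(ℝ, ℂ)) (f : 𝓢'(ℝ, ℂ)) (x : ℝ) :
    segmentFun (a • ψ) f x = a * segmentFun ψ f x := by
  simp [segmentFun, translation, FourierTransform.fourier_smul]

theorem segmentFun_sum {ι : Type*} (s : Finset ι) (ψ : ι → 𝓢(ℝ, ℂ)) (f : 𝓢'(ℝ, ℂ)) (x : ℝ) :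
    segmentFun (∑ i ∈ s, ψ i) f x = ∑ i ∈ s, segmentFun (ψ i) f x := by
  have h := map_sum (fourierTransformCLM ℂ (V := ℝ) (E := ℂ)) ψ s
  simp only [fourierTransformCLM_apply] at h
  simp [segmentFun, translation, h]

/-- The translate of `𝓕 χ` by `x` is the Fourier transform of a modulation of `χ`. Testing the
segment of `ψ` on it therefore gives the segment of the product, at `x`. -/
theorem segmentFun_mulSchwartz (χ ψ : 𝓢(ℝ, ℂ)) (f : 𝓢'(ℝ, ℂ)) (x : ℝ) :
    segmentFun (mulSchwartz χ ψ) f x = ∫ y, (𝓕⁻ χ : 𝓢(ℝ, ℂ)) (x - y) * segmentFun ψ f y := by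
  have h := (segmentation_eq_integral ψ (translation x (𝓕 χ)) f).2
  rw [segmentation_apply] at h
  have e1 : (𝓕 (mulSchwartz ψ (𝓕⁻ (translation x (𝓕 χ)))) : 𝓢(ℝ, ℂ)) =
      translation x (𝓕 (mulSchwartz χ ψ)) := by
    have e2 : (translation x (𝓕 χ) : 𝓢(ℝ, ℂ)) = 𝓕 (modulation x χ) := by
      ext t; rw [fourier_modulation_apply, translation_apply]
    rw [e2, FourierTransform.fourierInv_fourier_eq]
    ext t
    rw [translation_apply, ← fourier_modulation_apply]
    congr 2
    ext ξ
    simp only [mulSchwartz_apply, modulation_apply]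
    ring
  rw [e1] at h
  rw [segmentFun, h]
  congr 1
  funext y
  rw [translation_apply, ← fourierInv_neg_apply]
  congr 2; ring

/-! ### Multiplier estimates in `L^p` -/

/-- Young's inequality `‖K * u‖_p ≤ ‖K‖_1 ‖u‖_p` for continuous functions. -/
theorem eLpNorm_integral_mul_le {p : ℝ≥0∞} (hp : 1 ≤ p) {K u : ℝ → ℂ} (hK : Continuous K)
    (hu : Continuous u) :
    eLpNorm (fun x => ∫ y, K (x - y) * u y) p volume ≤
      eLpNorm K 1 volume * eLpNorm u p volume := by
  have hKs := hK.stronglyMeasurable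
  have hus := hu.stronglyMeasurable
  have hpt : ∀ x, ‖∫ y, K (x - y) * u y‖ₑ ≤ ∫⁻ y, ‖K (x - y)‖ₑ * ‖u y‖ₑ := by
    intro x
    refine (enorm_integral_le_lintegral_enorm _).trans_eq ?_
    simp only [enorm_mul]
  have hK1 : ∀ x, ∫⁻ y, ‖K (x - y)‖ₑ = eLpNorm K 1 volume := by
    intro x
    rw [eLpNorm_one_eq_lintegral_enorm]
    exact lintegral_sub_left_eq_self (fun y => ‖K y‖ₑ) x
  rcases eq_or_ne p ∞ with rfl | hp'
  · rw [eLpNorm_exponent_top, eLpNorm_exponent_top]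
    refine essSup_le_of_ae_le _ (Filter.Eventually.of_forall fun x => (hpt x).trans ?_)
    rw [← hK1 x, ← lintegral_mul_const _ (by fun_prop)]
    refine lintegral_mono_ae ?_
    filter_upwards [enorm_ae_le_eLpNormEssSup u volume] with y hy
    gcongr
  have hp0 : p ≠ 0 := (zero_lt_one.trans_le hp).ne'
  have hr : 1 ≤ p.toReal := by
    rw [← ENNReal.toReal_one]; exact (ENNReal.toReal_le_toReal ENNReal.one_ne_top hp').2 hp
  have hr0 : 0 < p.toReal := zero_lt_one.trans_le hr
  set r := p.toReal with hrdef
  set k := eLpNorm K 1 volume with hk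
  -- Comparison of the `L^1` and `L^r` norms for the measure `|K(x-y)| dy`, whose total mass `k`
  -- does not depend on `x`.
  have hhol : ∀ x, (∫⁻ y, ‖K (x - y)‖ₑ * ‖u y‖ₑ) ^ r ≤
      k ^ (r - 1) * ∫⁻ y, ‖K (x - y)‖ₑ * ‖u y‖ₑ ^ r := by
    intro x
    have hKm : Measurable fun y => ‖K (x - y)‖ₑ := by fun_prop
    let ν := (volume : Measure ℝ).withDensity fun y => ‖K (x - y)‖ₑ
    have hν : ν Set.univ = k := by
      rw [withDensity_apply _ MeasurableSet.univ, Measure.restrict_univ, hK1]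
    have h := eLpNorm'_le_eLpNorm'_mul_rpow_measure_univ (μ := ν) (f := u) zero_lt_one hr
      hu.aestronglyMeasurable
    rw [hν, eLpNorm', eLpNorm'] at h
    simp only [ENNReal.rpow_one, div_one] at h
    rw [lintegral_withDensity_eq_lintegral_mul _ hKm (by fun_prop),
      lintegral_withDensity_eq_lintegral_mul _ hKm (by fun_prop)] at h
    simp only [Pi.mul_apply] at h
    refine (ENNReal.rpow_le_rpow h hr0.le).trans_eq ?_
    rw [ENNReal.mul_rpow_of_nonneg _ _ hr0.le, ← ENNReal.rpow_mul, ← ENNReal.rpow_mul,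
      one_div_mul_cancel hr0.ne', ENNReal.rpow_one, mul_comm]
    congr 2
    field_simp
  rw [eLpNorm_eq_eLpNorm' hp0 hp', eLpNorm_eq_eLpNorm' hp0 hp', eLpNorm', eLpNorm']
  have hmain : ∫⁻ x, ‖∫ y, K (x - y) * u y‖ₑ ^ r ≤ k ^ r * ∫⁻ y, ‖u y‖ₑ ^ r := by
    calc ∫⁻ x, ‖∫ y, K (x - y) * u y‖ₑ ^ r
        ≤ ∫⁻ x, k ^ (r - 1) * ∫⁻ y, ‖K (x - y)‖ₑ * ‖u y‖ₑ ^ r :=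
          lintegral_mono fun x => (ENNReal.rpow_le_rpow (hpt x) hr0.le).trans (hhol x)
      _ = k ^ (r - 1) * ∫⁻ x, ∫⁻ y, ‖K (x - y)‖ₑ * ‖u y‖ₑ ^ r := by
          rw [lintegral_const_mul]
          exact Measurable.lintegral_prod_right' (f := fun z : ℝ × ℝ =>
            ‖K (z.1 - z.2)‖ₑ * ‖u z.2‖ₑ ^ r) (by fun_prop)
      _ = k ^ (r - 1) * ∫⁻ y, ∫⁻ x, ‖K (x - y)‖ₑ * ‖u y‖ₑ ^ r := by
          rw [lintegral_lintegral_swap]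
          exact Measurable.aemeasurable (by fun_prop)
      _ = k ^ (r - 1) * ∫⁻ y, k * ‖u y‖ₑ ^ r := by
          congr 2
          funext y
          rw [lintegral_mul_const _ (by fun_prop), hk, eLpNorm_one_eq_lintegral_enorm,
            lintegral_sub_right_eq_self (fun x => ‖K x‖ₑ) y]
      _ = k ^ r * ∫⁻ y, ‖u y‖ₑ ^ r := by
          rw [lintegral_const_mul _ (by fun_prop), ← mul_assoc]
          congr 1
          nth_rewrite 2 [← ENNReal.rpow_one k]
          rw [← ENNReal.rpow_add_of_nonneg _ _ (by linarith) zero_le_one]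
          congr 1; ring
  refine (ENNReal.rpow_le_rpow hmain (by positivity)).trans_eq ?_
  rw [ENNReal.mul_rpow_of_nonneg _ _ (by positivity), ← ENNReal.rpow_mul,
    mul_one_div_cancel hr0.ne', ENNReal.rpow_one]

theorem eLpNorm_segmentFun_mulSchwartz_le {p : ℝ≥0∞} (hp : 1 ≤ p) (χ ψ : 𝓢(ℝ, ℂ))
    (f : 𝓢'(ℝ, ℂ)) :
    eLpNorm (segmentFun (mulSchwartz χ ψ) f) p volume ≤
      eLpNorm (𝓕⁻ χ : 𝓢(ℝ, ℂ)) 1 volume * eLpNorm (segmentFun ψ f) p volume := by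
  have : segmentFun (mulSchwartz χ ψ) f =
      fun x => ∫ y, (𝓕⁻ χ : 𝓢(ℝ, ℂ)) (x - y) * segmentFun ψ f y :=
    funext (segmentFun_mulSchwartz χ ψ f)
  rw [this]
  exact eLpNorm_integral_mul_le hp (SchwartzMap.continuous _) (continuous_segmentFun ψ f)

theorem eLpNorm_segmentFun_sum_le {p : ℝ≥0∞} (hp : 1 ≤ p) {ι : Type*} (s : Finset ι)
    (ψ : ι → 𝓢(ℝ, ℂ)) (f : 𝓢'(ℝ, ℂ)) :
    eLpNorm (segmentFun (∑ i ∈ s, ψ i) f) p volume ≤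
      ∑ i ∈ s, eLpNorm (segmentFun (ψ i) f) p volume := by
  have : segmentFun (∑ i ∈ s, ψ i) f = ∑ i ∈ s, segmentFun (ψ i) f := by
    funext x; rw [segmentFun_sum, Finset.sum_apply]
  rw [this]
  exact eLpNorm_sum_le (fun i _ => (continuous_segmentFun _ f).aestronglyMeasurable) hp

theorem eLpNorm_segmentFun_smul {p : ℝ≥0∞} (a : ℂ) (ψ : 𝓢(ℝ, ℂ)) (f : 𝓢'(ℝ, ℂ)) :
    eLpNorm (segmentFun (a • ψ) f) p volume = ‖a‖ₑ * eLpNorm (segmentFun ψ f) p volume := by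
  have : segmentFun (a • ψ) f = a • segmentFun ψ f := by
    funext x; rw [segmentFun_smul]; rfl
  rw [this, eLpNorm_const_smul]

/-! ### The α-transform as a frequency segment -/

/-- The Fourier transform of `M_b D_a G`, the window `a ^ (1 / 2) * 𝓕 G (a * (ξ - b))`. -/
def freqWindow (a : ℝ) (ha : 0 < a) (b : ℝ) (G : 𝓢(ℝ, ℂ)) : 𝓢(ℝ, ℂ) :=
  𝓕 (modulation b (dilation a ha G))

theorem fourier_dilation_apply (a : ℝ) (ha : 0 < a) (G : 𝓢(ℝ, ℂ)) (ξ : ℝ) :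
    (𝓕 (dilation a ha G) : 𝓢(ℝ, ℂ)) ξ =
      ((a ^ (1 / 2 : ℝ) : ℝ) : ℂ) * (𝓕 G : 𝓢(ℝ, ℂ)) (a * ξ) := by
  rw [fourier_apply_integral, fourier_apply_integral]
  have h := Measure.integral_comp_div (fun s : ℝ =>
    Complex.exp (2 * Real.pi * Complex.I * (-(a * ξ) : ℝ) * s) *
      (((a ^ (-(1 / 2) : ℝ) : ℝ) : ℂ) * G s)) a
  have hl : (fun t : ℝ => Complex.exp (2 * Real.pi * Complex.I * (-ξ : ℝ) * t) *
      dilation a ha G t) = fun t : ℝ =>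
      Complex.exp (2 * Real.pi * Complex.I * (-(a * ξ) : ℝ) * (t / a : ℝ)) *
      (((a ^ (-(1 / 2) : ℝ) : ℝ) : ℂ) * G (t / a)) := by
    funext t
    rw [dilation_apply]
    congr 2
    have : (a : ℂ) ≠ 0 := by exact_mod_cast ha.ne'
    push_cast
    field_simp
  rw [hl, h, abs_of_pos ha, ← integral_const_mul, ← integral_smul]
  congr 1
  funext s
  have : a ^ (1 / 2 : ℝ) = a * a ^ (-(1 / 2) : ℝ) := by
    nth_rewrite 2 [← Real.rpow_one a]
    rw [← Real.rpow_add ha]; norm_num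
  rw [this, Complex.real_smul]
  push_cast
  ring

theorem freqWindow_apply (a : ℝ) (ha : 0 < a) (b : ℝ) (G : 𝓢(ℝ, ℂ)) (ξ : ℝ) :
    freqWindow a ha b G ξ =
      ((a ^ (1 / 2 : ℝ) : ℝ) : ℂ) * (𝓕 G : 𝓢(ℝ, ℂ)) (a * (ξ - b)) := by
  rw [freqWindow, fourier_modulation_apply, fourier_dilation_apply]

theorem fourierInv_freqWindow (a : ℝ) (ha : 0 < a) (b : ℝ) (G : 𝓢(ℝ, ℂ)) :
    𝓕⁻ (freqWindow a ha b G) = modulation b (dilation a ha G) :=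
  FourierTransform.fourierInv_fourier_eq _

theorem norm_char (ω t : ℝ) : ‖Complex.exp (2 * Real.pi * Complex.I * ω * t)‖ = 1 := by
  rw [Complex.norm_exp]; simp

/-- The dilation is normalized in `L²`, so it scales the `L¹` norm by `a^{1/2}`; modulation does not
change it. This is the source of the factor `(1+|ω|)^{-α/2}`. -/
theorem eLpNorm_one_fourierInv_freqWindow (a : ℝ) (ha : 0 < a) (b : ℝ) (G : 𝓢(ℝ, ℂ)) :
    eLpNorm (𝓕⁻ (freqWindow a ha b G) : 𝓢(ℝ, ℂ)) 1 volume =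
      ENNReal.ofReal (a ^ (1 / 2 : ℝ)) * eLpNorm G 1 volume := by
  rw [fourierInv_freqWindow, eLpNorm_one_eq_lintegral_enorm, eLpNorm_one_eq_lintegral_enorm,
    ← ofReal_integral_norm_eq_lintegral_enorm (SchwartzMap.integrable _),
    ← ofReal_integral_norm_eq_lintegral_enorm (SchwartzMap.integrable _),
    ← ENNReal.ofReal_mul (by positivity)]
  congr 1
  simp only [modulation_apply, dilation_apply, norm_mul, norm_char, one_mul]
  rw [integral_const_mul, Measure.integral_comp_div (fun t => ‖G t‖) a, Complex.norm_real,
    Real.norm_of_nonneg (by positivity), abs_of_pos ha, smul_eq_mul, ← mul_assoc]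
  congr 1
  nth_rewrite 2 [← Real.rpow_one a]
  rw [← Real.rpow_add ha]; norm_num

/-- The conjugate symmetry of `g` turns the conjugated atom into the reflected kernel of a
convolution. -/
theorem alphaTransform_eq_segmentFun (α c : ℝ) (hc : 0 < c) {g : 𝓢(ℝ, ℂ)}
    (hg : ∀ t, conj (g t) = g (-t)) (f : 𝓢'(ℝ, ℂ)) (x ω : ℝ) :
    alphaTransform α c hc g f (x, ω) =
      segmentFun (freqWindow (c * (1 + |ω|) ^ (-α)) (scale_pos hc α ω) ω g) f x := by
  rw [alphaTransform, segmentFun]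
  congr 1
  ext t
  rw [conjSchwartz_apply, atom, translation_apply, translation_apply, ← fourierInv_neg_apply,
    fourierInv_freqWindow, modulation_apply, modulation_apply, dilation_apply, dilation_apply,
    map_mul, map_mul, hg, ← Complex.exp_conj, Complex.conj_ofReal]
  congr 2
  · have h2 : conj (2 : ℂ) = 2 := Complex.conj_ofNat 2
    simp only [map_mul, h2, Complex.conj_ofReal, Complex.conj_I]
    push_cast
    ring
  · rw [neg_div]

/-! ### Cutoffs, partitions of unity and measurability -/

/-- Real-valued smooth cutoff functions, as Schwartz functions. -/
theorem exists_cutoff {r R : ℝ} (hr : 0 < r) (hR : r < R) :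
    ∃ η : 𝓢(ℝ, ℂ), (∀ ξ, conj (η ξ) = η ξ) ∧ (∀ ξ, |ξ| ≤ r → η ξ = 1) ∧
      ∀ ξ, R ≤ |ξ| → η ξ = 0 := by
  let b : ContDiffBump (0 : ℝ) := ⟨r, R, hr, hR⟩
  refine ⟨HasCompactSupport.toSchwartzMap (f := fun x => (b x : ℂ))
    (b.hasCompactSupport.comp_left (g := fun r : ℝ => (r : ℂ)) (by simp))
    (Complex.ofRealCLM.contDiff.comp b.contDiff), fun ξ => Complex.conj_ofReal _,
    fun ξ hξ => ?_, fun ξ hξ => ?_⟩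
  · change ((b ξ : ℝ) : ℂ) = 1
    rw [b.one_of_mem_closedBall (by simpa using hξ), Complex.ofReal_one]
  · change ((b ξ : ℝ) : ℂ) = 0
    rw [b.zero_of_le_dist (by simpa using hξ), Complex.ofReal_zero]

/-- A smooth partition of unity by integer translates of one function supported in `[-1, 1]`. -/
theorem exists_translation_partition :
    ∃ χ : 𝓢(ℝ, ℂ), (∀ ξ, 1 ≤ |ξ| → χ ξ = 0) ∧ ∀ (M : ℕ) (t : ℝ), |t| ≤ M →
      ∑ j ∈ Finset.range (2 * M + 1), χ (t - ((j : ℝ) - M)) = 1 := by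
  obtain ⟨S, hS0, hS1, hS⟩ : ∃ S : ℝ → ℝ, (∀ x ≤ 0, S x = 0) ∧ (∀ x, 1 ≤ x → S x = 1) ∧
      ContDiff ℝ (⊤ : ℕ∞) S :=
    ⟨Real.smoothTransition, fun _ => Real.smoothTransition.zero_of_nonpos,
      fun _ => Real.smoothTransition.one_of_one_le, Real.smoothTransition.contDiff⟩
  have h0 : ∀ ξ : ℝ, 1 ≤ |ξ| → S (ξ + 1) - S ξ = 0 := by
    intro ξ hξ
    rcases le_abs.1 hξ with h | h
    · rw [hS1 _ (by linarith), hS1 _ h, sub_self]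
    · rw [hS0 _ (by linarith), hS0 _ (by linarith), sub_self]
  have hsupp : HasCompactSupport fun ξ : ℝ => ((S (ξ + 1) - S ξ : ℝ) : ℂ) := by
    refine HasCompactSupport.intro (isCompact_closedBall (0 : ℝ) 1) fun ξ hξ => ?_
    rw [Metric.mem_closedBall, dist_zero_right, Real.norm_eq_abs, not_le] at hξ
    rw [h0 ξ hξ.le, Complex.ofReal_zero]
  have hsm : ContDiff ℝ (⊤ : ℕ∞) fun ξ : ℝ => ((S (ξ + 1) - S ξ : ℝ) : ℂ) := by
    refine Complex.ofRealCLM.contDiff.comp (ContDiff.sub ?_ hS)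
    exact hS.comp (contDiff_id.add contDiff_const)
  refine ⟨hsupp.toSchwartzMap hsm, fun ξ hξ => ?_, fun M t ht => ?_⟩
  · change ((S (ξ + 1) - S ξ : ℝ) : ℂ) = 0
    rw [h0 ξ hξ, Complex.ofReal_zero]
  · change ∑ j ∈ Finset.range (2 * M + 1),
      ((S (t - ((j : ℝ) - M) + 1) - S (t - ((j : ℝ) - M)) : ℝ) : ℂ) = 1
    rw [← Complex.ofReal_sum]
    -- The sum telescopes to `S(t+M+1) - S(t-M)`, which is `1 - 0` when `|t| ≤ M`.
    have h1 := Finset.sum_range_sub' (fun j : ℕ => S (t + M + 1 - j)) (2 * M + 1)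
    have h2 : ∑ j ∈ Finset.range (2 * M + 1),
        (S (t - ((j : ℝ) - M) + 1) - S (t - ((j : ℝ) - M))) =
        S (t + M + 1 - (0 : ℕ)) - S (t + M + 1 - (2 * M + 1 : ℕ)) := by
      rw [← h1]
      refine Finset.sum_congr rfl fun j _ => ?_
      congr 2
      · ring
      · push_cast; ring
    obtain ⟨h3, h4⟩ := abs_le.1 ht
    rw [h2, hS1 _ (by push_cast; linarith), hS0 _ (by push_cast; linarith)]
    simp

/-- For band-limited `g` the α-transform of a tempered distribution is a measurable function. -/
theorem stronglyMeasurable_alphaTransform (α c : ℝ) (hc : 0 < c) {g : 𝓢(ℝ, ℂ)}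
    (hg : ∀ t, conj (g t) = g (-t)) {R : ℝ} (hR : ∀ ξ, R ≤ |ξ| → (𝓕 g : 𝓢(ℝ, ℂ)) ξ = 0)
    (f : 𝓢'(ℝ, ℂ)) : StronglyMeasurable (alphaTransform α c hc g f) := by
  have hcut : ∀ n : ℕ, ∃ η : 𝓢(ℝ, ℂ), ∀ ξ : ℝ, |ξ| ≤ n + 1 → η ξ = 1 := fun n =>
    let ⟨η, _, h, _⟩ := exists_cutoff (r := n + 1) (R := n + 2) (by positivity) (by linarith)
    ⟨η, h⟩
  choose η hη using hcut
  -- With `f` cut off in frequency, the transform is a parameter integral with jointly continuous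
  -- integrand, hence measurable.
  let u : ℕ → ℝ × ℝ → ℂ := fun n z => ∫ y : ℝ,
    modulation z.2 (dilation (c * (1 + |z.2|) ^ (-α)) (scale_pos hc α z.2) g) (z.1 - y) *
      segmentFun (η n) f y
  have hu : ∀ n, StronglyMeasurable (u n) := by
    intro n
    refine StronglyMeasurable.integral_prod_right (f := fun (z : ℝ × ℝ) (y : ℝ) =>
      modulation z.2 (dilation (c * (1 + |z.2|) ^ (-α)) (scale_pos hc α z.2) g) (z.1 - y) *
        segmentFun (η n) f y) ?_
    refine Continuous.stronglyMeasurable ?_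
    have h1 := continuous_segmentFun (η n) f
    have h2 := g.continuous
    have h3 : Continuous fun z : (ℝ × ℝ) × ℝ => c * (1 + |z.1.2|) ^ (-α) :=
      continuous_const.mul (Continuous.rpow_const (by fun_prop) fun z => Or.inl (by positivity))
    have h4 : Continuous fun z : (ℝ × ℝ) × ℝ => (c * (1 + |z.1.2|) ^ (-α)) ^ (-(1 / 2) : ℝ) :=
      h3.rpow_const fun z => Or.inl (scale_pos hc α z.1.2).ne'
    have h5 : Continuous fun z : (ℝ × ℝ) × ℝ => (z.1.1 - z.2) / (c * (1 + |z.1.2|) ^ (-α)) :=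
      Continuous.div (by fun_prop) h3 fun z => (scale_pos hc α z.1.2).ne'
    simp only [Function.uncurry_def, modulation_apply, dilation_apply]
    fun_prop
  refine stronglyMeasurable_of_tendsto Filter.atTop hu (tendsto_pi_nhds.2 fun z => ?_)
  obtain ⟨x, ω⟩ := z
  set a := c * (1 + |ω|) ^ (-α) with ha
  have ha0 : 0 < a := scale_pos hc α ω
  -- The window at `ω` vanishes for `|ξ| ≥ R/a + |ω|`, so from `N` on the cutoff has no effect and
  -- the approximants are constant.
  obtain ⟨N, hN⟩ := exists_nat_ge (R / a + |ω|)
  refine tendsto_const_nhds.congr' ?_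
  filter_upwards [Filter.eventually_ge_atTop N] with n hn
  rw [alphaTransform_eq_segmentFun α c hc hg]
  have hmul : freqWindow a ha0 ω g = mulSchwartz (freqWindow a ha0 ω g) (η n) := by
    ext ξ
    rw [mulSchwartz_apply]
    by_cases h : |ξ| ≤ n + 1
    · rw [hη n ξ h, mul_one]
    · rw [freqWindow_apply, hR, mul_zero, zero_mul]
      have hn' : (N : ℝ) ≤ n := by exact_mod_cast hn
      have h1 : |ξ| ≤ |ξ - ω| + |ω| := by simpa using abs_add_le (ξ - ω) ω
      have h2 : R / a ≤ |ξ - ω| := by linarith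
      rw [abs_mul, abs_of_pos ha0, mul_comm]
      exact (div_le_iff₀ ha0).1 h2
  change segmentFun (freqWindow a ha0 ω g) f x = u n (x, ω)
  rw [hmul, segmentFun_mulSchwartz, fourierInv_freqWindow]

/-! ### Sums of measures with bounded overlap -/

/-- Integrate the counting function of the sets: it is at most `N` on `K` and zero outside. -/
theorem sum_measure_le_of_overlap {X ι : Type*} [MeasurableSpace X] (μ : Measure X)
    {t : ι → Set X} (ht : ∀ i, MeasurableSet (t i)) (s : Finset ι) {K : Set X}
    (hK : ∀ i ∈ s, t i ⊆ K) (hKm : MeasurableSet K) {N : ℕ}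
    (hN : ∀ x, ∀ s' ⊆ s, (∀ i ∈ s', x ∈ t i) → s'.card ≤ N) :
    ∑ i ∈ s, μ (t i) ≤ N * μ K := by
  classical
  calc ∑ i ∈ s, μ (t i) = ∫⁻ x, ∑ i ∈ s, (t i).indicator 1 x ∂μ := by
        rw [lintegral_finsetSum _ fun i _ => measurable_one.indicator (ht i)]
        exact Finset.sum_congr rfl fun i _ => (lintegral_indicator_one (ht i)).symm
    _ ≤ ∫⁻ x, K.indicator (fun _ => (N : ℝ≥0∞)) x ∂μ := by
        refine lintegral_mono fun x => ?_
        by_cases hx : x ∈ K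
        · rw [Set.indicator_of_mem hx]
          have : ∑ i ∈ s, (t i).indicator (1 : X → ℝ≥0∞) x =
              ((s.filter fun i => x ∈ t i).card : ℝ≥0∞) := by
            simp [Set.indicator_apply]
          change ∑ i ∈ s, (t i).indicator (1 : X → ℝ≥0∞) x ≤ N
          rw [this]
          exact_mod_cast hN x _ (Finset.filter_subset _ _)
            fun i hi => (Finset.mem_filter.1 hi).2
        · refine le_of_eq_of_le (Finset.sum_eq_zero fun i hi => ?_) zero_le
          exact Set.indicator_of_notMem (fun h => hx (hK i hi h)) _
    _ = N * μ K := by rw [lintegral_indicator_const hKm]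

theorem sum_restrict_le_of_overlap {X ι : Type*} [MeasurableSpace X] (μ : Measure X)
    {t : ι → Set X} (ht : ∀ i, MeasurableSet (t i)) (s : Finset ι) {N : ℕ}
    (hN : ∀ x, ∀ s' : Finset ι, (∀ i ∈ s', x ∈ t i) → s'.card ≤ N) :
    ∑ i ∈ s, μ.restrict (t i) ≤ (N : ℝ≥0∞) • μ := by
  refine Measure.le_iff.2 fun E hE => ?_
  rw [Measure.finsetSum_apply, Measure.smul_apply, smul_eq_mul]
  simp only [Measure.restrict_apply hE]
  exact sum_measure_le_of_overlap μ (fun i => hE.inter (ht i)) s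
    (fun i _ => Set.inter_subset_left) hE fun x s' _ h => hN x s' fun i hi => (h i hi).2

/-! ### Comparison of `L^q` norms and `ℓ^q` norms -/

theorem toReal_inv_eq (q : ℝ≥0∞) : (q⁻¹).toReal = 1 / q.toReal := by
  rw [ENNReal.toReal_inv, one_div]

/-- A function that is pointwise bounded by one of the coefficients attached to the sets
containing the point has its `L^q` norm bounded by a weighted `ℓ^q` norm. -/
theorem eLpNorm_le_lqNorm {ι : Type*} [Countable ι] {q : ℝ≥0∞} (hq : 1 ≤ q) {W : ℝ → ℝ≥0∞}
    {γ h : ι → ℝ≥0∞} {U : ι → Set ℝ} (hU : ∀ i, MeasurableSet (U i)) {C D : ℝ≥0∞}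
    (hvol : ∀ i, volume (U i) ≤ D * h i) (hW : ∀ ω, ∃ i, ω ∈ U i ∧ W ω ≤ C * γ i) :
    eLpNorm W q volume ≤
      C * D ^ (q⁻¹).toReal * lqNorm q fun i => γ i * h i ^ (q⁻¹).toReal := by
  rcases eq_or_ne q ∞ with rfl | hq'
  · simp only [lqNorm, if_true, ENNReal.inv_top, ENNReal.toReal_zero, ENNReal.rpow_zero, mul_one,
      eLpNorm_exponent_top]
    refine essSup_le_of_ae_le _ (Filter.Eventually.of_forall fun ω => ?_)
    obtain ⟨i, -, hi⟩ := hW ω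
    exact hi.trans (mul_le_mul' le_rfl (le_iSup γ i))
  have hr : 0 < q.toReal := ENNReal.toReal_pos (zero_lt_one.trans_le hq).ne' hq'
  rw [lqNorm, if_neg hq', eLpNorm_eq_eLpNorm' (zero_lt_one.trans_le hq).ne' hq', eLpNorm',
    toReal_inv_eq]
  simp only [enorm_eq_self]
  set r := q.toReal
  have hmain : ∫⁻ ω, W ω ^ r ≤ C ^ r * D * ∑' i, (γ i * h i ^ (1 / r)) ^ r := by
    calc ∫⁻ ω, W ω ^ r ≤ ∫⁻ ω, ∑' i, (U i).indicator (fun _ => (C * γ i) ^ r) ω := by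
          refine lintegral_mono fun ω => ?_
          obtain ⟨i, hi, hWi⟩ := hW ω
          refine (ENNReal.rpow_le_rpow hWi hr.le).trans ?_
          refine le_trans ?_ (ENNReal.le_tsum i)
          rw [Set.indicator_of_mem hi]
      _ = ∑' i, (C * γ i) ^ r * volume (U i) := by
          rw [lintegral_tsum fun i => (measurable_const.indicator (hU i)).aemeasurable]
          simp only [lintegral_indicator_const (hU _)]
      _ ≤ ∑' i, C ^ r * D * (γ i * h i ^ (1 / r)) ^ r := by
          refine ENNReal.tsum_le_tsum fun i => ?_
          rw [ENNReal.mul_rpow_of_nonneg _ _ hr.le, ENNReal.mul_rpow_of_nonneg _ _ hr.le,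
            ← ENNReal.rpow_mul, one_div_mul_cancel hr.ne', ENNReal.rpow_one]
          calc C ^ r * γ i ^ r * volume (U i) ≤ C ^ r * γ i ^ r * (D * h i) := by
                gcongr; exact hvol i
            _ = _ := by ring
      _ = _ := ENNReal.tsum_mul_left
  refine (ENNReal.rpow_le_rpow hmain (by positivity)).trans_eq ?_
  rw [ENNReal.mul_rpow_of_nonneg _ _ (by positivity), ENNReal.mul_rpow_of_nonneg _ _
    (by positivity), ← ENNReal.rpow_mul, mul_one_div_cancel hr.ne', ENNReal.rpow_one]

/-- Coefficients that bound a function from below on sets of bounded overlap have their weighted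
`ℓ^q` norm bounded by the `L^q` norm of the function. -/
theorem lqNorm_le_eLpNorm {ι : Type*} {q : ℝ≥0∞} (hq : 1 ≤ q) {W : ℝ → ℝ≥0∞}
    {γ h : ι → ℝ≥0∞} {J : ι → Set ℝ} (hJ : ∀ i, MeasurableSet (J i)) {C : ℝ≥0} {D : ℝ≥0∞}
    (hpos : ∀ i, volume (J i) ≠ 0) (hvol : ∀ i, h i ≤ D * volume (J i))
    (hW : ∀ i, ∀ ω ∈ J i, γ i ≤ C * W ω) {N : ℕ}
    (hN : ∀ ω, ∀ s : Finset ι, (∀ i ∈ s, ω ∈ J i) → s.card ≤ N) :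
    lqNorm q (fun i => γ i * h i ^ (q⁻¹).toReal) ≤
      C * (D * N) ^ (q⁻¹).toReal * eLpNorm W q volume := by
  rcases eq_or_ne q ∞ with rfl | hq'
  · simp only [lqNorm, if_true, ENNReal.inv_top, ENNReal.toReal_zero, ENNReal.rpow_zero, mul_one,
      eLpNorm_exponent_top]
    refine iSup_le fun i => ?_
    have hae : ∀ᵐ ω, W ω ≤ eLpNormEssSup W volume := by
      simpa using enorm_ae_le_eLpNormEssSup W volume
    -- The essential supremum bounds `W` only almost everywhere; the positive measure of `J i`
    -- provides a good point in it.
    obtain ⟨ω, hω, hWω⟩ : ∃ ω ∈ J i, W ω ≤ eLpNormEssSup W volume := by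
      by_contra hcon
      push Not at hcon
      exact hpos i (measure_mono_null (fun ω hω => not_le.2 (hcon ω hω)) hae)
    refine (hW i ω hω).trans ?_
    gcongr
  have hr : 0 < q.toReal := ENNReal.toReal_pos (zero_lt_one.trans_le hq).ne' hq'
  rw [lqNorm, if_neg hq', eLpNorm_eq_eLpNorm' (zero_lt_one.trans_le hq).ne' hq', eLpNorm',
    toReal_inv_eq]
  simp only [enorm_eq_self]
  set r := q.toReal
  -- A finite constant can be pulled out of the integral without measurability of `W`.
  have hC : (C : ℝ≥0∞) ^ r ≠ ∞ := ENNReal.rpow_ne_top_of_nonneg hr.le ENNReal.coe_ne_top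
  have hterm : ∀ i, (γ i * h i ^ (1 / r)) ^ r ≤
      (C : ℝ≥0∞) ^ r * D * ∫⁻ ω, W ω ^ r ∂volume.restrict (J i) := by
    intro i
    rw [ENNReal.mul_rpow_of_nonneg _ _ hr.le, ← ENNReal.rpow_mul, one_div_mul_cancel hr.ne',
      ENNReal.rpow_one]
    calc γ i ^ r * h i ≤ γ i ^ r * (D * volume (J i)) := by gcongr; exact hvol i
      _ = D * ∫⁻ _ in J i, γ i ^ r := by rw [setLIntegral_const]; ring
      _ ≤ D * ∫⁻ ω in J i, (C : ℝ≥0∞) ^ r * W ω ^ r := by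
          gcongr 1
          refine setLIntegral_mono' (hJ i) fun ω hω => ?_
          rw [← ENNReal.mul_rpow_of_nonneg _ _ hr.le]
          exact ENNReal.rpow_le_rpow (hW i ω hω) hr.le
      _ = _ := by rw [lintegral_const_mul' _ _ hC]; ring
  have hmain : ∑' i, (γ i * h i ^ (1 / r)) ^ r ≤
      (C : ℝ≥0∞) ^ r * (D * N) * ∫⁻ ω, W ω ^ r := by
    rw [ENNReal.tsum_eq_iSup_sum]
    refine iSup_le fun s => ?_
    calc ∑ i ∈ s, (γ i * h i ^ (1 / r)) ^ r
        ≤ ∑ i ∈ s, (C : ℝ≥0∞) ^ r * D * ∫⁻ ω, W ω ^ r ∂volume.restrict (J i) :=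
          Finset.sum_le_sum fun i _ => hterm i
      _ = (C : ℝ≥0∞) ^ r * D * ∫⁻ ω, W ω ^ r ∂(∑ i ∈ s, volume.restrict (J i)) := by
          rw [lintegral_finsetSum_measure, Finset.mul_sum]
      _ ≤ (C : ℝ≥0∞) ^ r * D * ∫⁻ ω, W ω ^ r ∂((N : ℝ≥0∞) • volume) := by
          gcongr 1
          exact lintegral_mono' (sum_restrict_le_of_overlap volume hJ s hN) le_rfl
      _ = _ := by rw [lintegral_smul_measure, smul_eq_mul]; ring
  refine (ENNReal.rpow_le_rpow hmain (by positivity)).trans_eq ?_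
  rw [ENNReal.mul_rpow_of_nonneg _ _ (by positivity), ENNReal.mul_rpow_of_nonneg _ _
    (by positivity), ← ENNReal.rpow_mul, mul_one_div_cancel hr.ne', ENNReal.rpow_one]

/-! ### Proximity at the scale `(1 + |ξ|) ^ α` -/

/-- Two points are near if their distance is at most `R` times the scale at either point. -/
def Near (α R x y : ℝ) : Prop :=
  |x - y| ≤ R * (1 + |x|) ^ α ∧ |x - y| ≤ R * (1 + |y|) ^ α

theorem one_add_abs_rpow_le {α : ℝ} (hα : α ∈ Set.Icc (0 : ℝ) 1) (x : ℝ) :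
    (1 + |x|) ^ α ≤ 1 + |x| := by
  have h : 1 ≤ 1 + |x| := by linarith [abs_nonneg x]
  simpa using Real.rpow_le_rpow_of_exponent_le h hα.2

namespace Near

variable {α R R' x y z : ℝ}

theorem symm (h : Near α R x y) : Near α R y x :=
  ⟨by rw [abs_sub_comm]; exact h.2, by rw [abs_sub_comm]; exact h.1⟩

theorem one_add_abs_le (hα : α ∈ Set.Icc (0 : ℝ) 1) (hR : 0 ≤ R) (h : Near α R x y) :
    1 + |x| ≤ (1 + R) * (1 + |y|) := by
  have h1 : |x| ≤ |x - y| + |y| := by simpa using abs_add_le (x - y) y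
  have h2 := mul_le_mul_of_nonneg_left (one_add_abs_rpow_le hα y) hR
  linarith [h.2]

/-- Nearness makes `1+|x|` and `1+|y|` comparable in both directions; the sign of `r` decides which
direction is used, hence `|r|`. -/
theorem rpow_le (hα : α ∈ Set.Icc (0 : ℝ) 1) (hR : 0 ≤ R) (h : Near α R x y) (r : ℝ) :
    (1 + |x|) ^ r ≤ (1 + R) ^ |r| * (1 + |y|) ^ r := by
  rcases le_total 0 r with hr | hr
  · rw [abs_of_nonneg hr, ← Real.mul_rpow (by positivity) (by positivity)]
    exact Real.rpow_le_rpow (by positivity) (h.one_add_abs_le hα hR) hr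
  · rw [abs_of_nonpos hr, Real.rpow_neg (by positivity), ← Real.inv_rpow (by positivity),
      ← Real.mul_rpow (by positivity) (by positivity)]
    refine Real.rpow_le_rpow_of_nonpos (by positivity) ?_ hr
    rw [inv_mul_le_iff₀ (by positivity)]
    exact h.symm.one_add_abs_le hα hR

theorem scale_le (hα : α ∈ Set.Icc (0 : ℝ) 1) (hR : 0 ≤ R) (h : Near α R x y) :
    (1 + |x|) ^ α ≤ (1 + R) * (1 + |y|) ^ α := by
  refine (h.rpow_le hα hR α).trans ?_
  gcongr
  rw [abs_of_nonneg hα.1]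
  simpa using Real.rpow_le_rpow_of_exponent_le (by linarith : 1 ≤ 1 + R) hα.2

/-- The term `R * R'` pays for moving the scale at `y` to an endpoint. -/
theorem trans (hα : α ∈ Set.Icc (0 : ℝ) 1) (hR : 0 ≤ R) (hR' : 0 ≤ R') (h : Near α R x y)
    (h' : Near α R' y z) : Near α (R + R' + R * R') x z := by
  have h1 : |x - z| ≤ |x - y| + |y - z| := abs_sub_le x y z
  have h2 := mul_le_mul_of_nonneg_left (h.symm.scale_le hα hR) hR'
  have h3 := mul_le_mul_of_nonneg_left (h'.scale_le hα hR') hR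
  constructor
  · nlinarith [h.1, h'.1]
  · nlinarith [h.2, h'.2]

/-- A one-sided bound suffices for small `R`: the displacement is at most half of `1+|y|`, so the
scale at `y` is at most twice that at `x`. -/
theorem of_le (hα : α ∈ Set.Icc (0 : ℝ) 1) (hR : R ≤ 1 / 2)
    (h : |x - y| ≤ R * (1 + |y|) ^ α) : Near α (2 * R) x y := by
  have hpos : 0 < (1 + |y|) ^ α := by positivity
  have hR0 : 0 ≤ R := by
    by_contra hneg
    nlinarith [abs_nonneg (x - y)]
  refine ⟨?_, h.trans (by nlinarith)⟩
  have h1 : |y| ≤ |x - y| + |x| := by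
    rw [abs_sub_comm]; simpa using abs_add_le (y - x) x
  have h2 := one_add_abs_rpow_le hα y
  have h3 : 1 + |y| ≤ 2 * (1 + |x|) := by nlinarith
  have h4 : (1 + |y|) ^ α ≤ 2 * (1 + |x|) ^ α := by
    calc (1 + |y|) ^ α ≤ (2 * (1 + |x|)) ^ α := Real.rpow_le_rpow (by positivity) h3 hα.1
      _ = 2 ^ α * (1 + |x|) ^ α := Real.mul_rpow (by positivity) (by positivity)
      _ ≤ 2 * (1 + |x|) ^ α := by
          gcongr
          simpa using Real.rpow_le_rpow_of_exponent_le (by norm_num : (1 : ℝ) ≤ 2) hα.2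
  nlinarith

end Near

theorem measurableSet_near (α R y : ℝ) : MeasurableSet {x | Near α R x y} := by
  have h1 : Measurable fun x : ℝ => |x - y| := by fun_prop
  have h2 : Measurable fun x : ℝ => R * (1 + |x|) ^ α := by fun_prop
  exact (measurableSet_le h1 h2).inter (measurableSet_le h1 measurable_const)

theorem volume_near_le (α R y : ℝ) :
    volume {x | Near α R x y} ≤ ENNReal.ofReal (2 * R * (1 + |y|) ^ α) := by
  calc volume {x | Near α R x y} ≤ volume (Metric.closedBall y (R * (1 + |y|) ^ α)) :=
        measure_mono fun x hx => by simpa [Real.dist_eq] using hx.2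
    _ = _ := by rw [Real.volume_closedBall, mul_assoc]

theorem ofReal_abs_sub_le_volume {I : Set ℝ} (hI : I.OrdConnected) {x y : ℝ} (hx : x ∈ I)
    (hy : y ∈ I) : ENNReal.ofReal |x - y| ≤ volume I := by
  have h : Set.uIcc x y ⊆ I := hI.uIcc_subset hx hy
  calc ENNReal.ofReal |x - y| = volume (Set.uIcc x y) := by
        rw [Real.volume_interval, abs_sub_comm]
    _ ≤ _ := measure_mono h

theorem near_of_mem {α B : ℝ} (hB : 0 ≤ B) {I : Set ℝ} (hI : I.OrdConnected)
    (hvol : ∀ ξ ∈ I, volume I ≤ ENNReal.ofReal (B * (1 + |ξ|) ^ α)) {x y : ℝ} (hx : x ∈ I)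
    (hy : y ∈ I) : Near α B x y := by
  have h := ofReal_abs_sub_le_volume hI hx hy
  exact ⟨(ENNReal.ofReal_le_ofReal_iff (by positivity)).1 (h.trans (hvol x hx)),
    (ENNReal.ofReal_le_ofReal_iff (by positivity)).1 (h.trans (hvol y hy))⟩

/-- A point is near only boundedly many intervals of an α-covering. -/
theorem IsAlphaCovering.exists_card_near_le {α : ℝ} (hα : α ∈ Set.Icc (0 : ℝ) 1)
    {𝓘 : Set (Set ℝ)} (h𝓘 : IsAlphaCovering α 𝓘) {ω : 𝓘 → ℝ} (hω : ∀ I : 𝓘, ω I ∈ (I : Set ℝ))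
    {R : ℝ} (hR : 0 ≤ R) :
    ∃ N : ℕ, ∀ x, ∀ s : Finset 𝓘, (∀ I ∈ s, Near α R x (ω I)) → s.card ≤ N := by
  classical
  obtain ⟨A, B, hA, hB, hsize⟩ := h𝓘.size
  -- Volume count: with `h` the scale at `x`, the intervals lie in a ball of radius `(R + B(1+R))h`,
  -- have length at least `Ah/(1+R)`, and overlap at most twice.
  obtain ⟨N, hN⟩ := exists_nat_ge (4 * (R + B * (1 + R)) * (1 + R) / A)
  refine ⟨N, fun x s hs => ?_⟩
  set h := (1 + |x|) ^ α with hh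
  have hpos : 0 < h := by positivity
  have hsub : ∀ I ∈ s, (I : Set ℝ) ⊆ Metric.closedBall x ((R + B * (1 + R)) * h) := by
    intro I hI y hy
    have h1 := near_of_mem hB.le (h𝓘.interval I I.2) (fun ξ hξ => (hsize I I.2 ξ hξ).2) hy (hω I)
    have h2 := hs I hI
    have h3 := mul_le_mul_of_nonneg_left (h2.symm.scale_le hα hR) hB.le
    rw [Metric.mem_closedBall, Real.dist_eq]
    have h4 : |y - x| ≤ |y - ω I| + |ω I - x| := abs_sub_le _ _ _
    rw [abs_sub_comm (ω I) x] at h4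
    nlinarith [h1.2, h2.1]
  have hlow : ∀ I ∈ s, ENNReal.ofReal (A * h / (1 + R)) ≤ volume (I : Set ℝ) := by
    intro I hI
    refine le_trans ?_ (hsize I I.2 (ω I) (hω I)).1
    refine ENNReal.ofReal_le_ofReal ?_
    rw [div_le_iff₀ (by positivity)]
    have := mul_le_mul_of_nonneg_left ((hs I hI).scale_le hα hR) hA.le
    linarith
  have hover : ∀ y, ∀ s' ⊆ s, (∀ I ∈ s', y ∈ (I : Set ℝ)) → s'.card ≤ 2 := by
    intro y s' _ hs'
    have h1 : ((s'.image Subtype.val : Finset (Set ℝ)) : Set (Set ℝ)) ⊆ {I ∈ 𝓘 | y ∈ I} := by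
      intro I hI
      obtain ⟨I', hI', rfl⟩ := Finset.mem_image.1 (Finset.mem_coe.1 hI)
      exact ⟨I'.2, hs' I' hI'⟩
    have h2 := (Set.encard_le_encard h1).trans (h𝓘.overlap y)
    rw [Set.encard_coe_eq_coe_finsetCard, Finset.card_image_of_injective _
      Subtype.val_injective] at h2
    exact_mod_cast h2
  have hsum := sum_measure_le_of_overlap volume
    (fun I : 𝓘 => (h𝓘.interval I I.2).measurableSet) s hsub Metric.isClosed_closedBall.measurableSet
    hover
  have h5 : (s.card : ℝ≥0∞) * ENNReal.ofReal (A * h / (1 + R)) ≤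
      (2 : ℕ) * ENNReal.ofReal (2 * ((R + B * (1 + R)) * h)) := by
    rw [Real.volume_closedBall] at hsum
    refine le_trans ?_ hsum
    rw [← nsmul_eq_mul]
    exact Finset.card_nsmul_le_sum s _ _ hlow
  rw [← ENNReal.ofReal_natCast, ← ENNReal.ofReal_natCast, ← ENNReal.ofReal_mul (by positivity),
    ← ENNReal.ofReal_mul (by positivity), ENNReal.ofReal_le_ofReal_iff (by positivity)] at h5
  have h6 : (s.card : ℝ) ≤ 4 * (R + B * (1 + R)) * (1 + R) / A := by
    rw [le_div_iff₀ hA]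
    have h7 : (s.card : ℝ) * (A * h / (1 + R)) * (1 + R) ≤
        (2 : ℕ) * (2 * ((R + B * (1 + R)) * h)) * (1 + R) := by gcongr
    have h8 : (s.card : ℝ) * (A * h / (1 + R)) * (1 + R) = (s.card * A) * h := by
      field_simp
    rw [h8] at h7
    refine le_of_mul_le_mul_right (h7.trans_eq ?_) hpos
    push_cast; ring
  exact_mod_cast h6.trans hN

/-! ### The window and its rescalings -/

/-- A band-limited window whose Fourier transform is a real cutoff function at scale `c`. -/
theorem exists_window {c : ℝ} (hc : 0 < c) :
    ∃ g : 𝓢(ℝ, ℂ), g ≠ 0 ∧ IsBandLimited g ∧ (∀ t, conj (g t) = g (-t)) ∧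
      (∀ ξ, |ξ| ≤ c / 4 → (𝓕 g : 𝓢(ℝ, ℂ)) ξ = 1) ∧
      ∀ ξ, c / 2 ≤ |ξ| → (𝓕 g : 𝓢(ℝ, ℂ)) ξ = 0 := by
  obtain ⟨θ, hconj, h1, h0⟩ := exists_cutoff (r := c / 4) (R := c / 2) (by positivity)
    (by linarith)
  have hθ : 𝓕 (𝓕⁻ θ : 𝓢(ℝ, ℂ)) = θ := FourierTransform.fourier_fourierInv_eq θ
  refine ⟨𝓕⁻ θ, ?_, ?_, fun t => ?_, by rwa [hθ], by rwa [hθ]⟩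
  · intro h
    have e : θ 0 = 1 := h1 0 (by rw [abs_zero]; positivity)
    rw [← hθ, h, FourierTransform.fourier_zero] at e
    exact zero_ne_one e
  · rw [IsBandLimited, hθ]
    refine HasCompactSupport.intro (isCompact_closedBall (0 : ℝ) (c / 2)) fun ξ hξ => ?_
    rw [Metric.mem_closedBall, dist_zero_right, Real.norm_eq_abs, not_le] at hξ
    exact h0 ξ hξ.le
  · rw [fourierInv_apply_integral, fourierInv_apply_integral, ← integral_conj]
    refine integral_congr_ae (Filter.Eventually.of_forall fun ξ => ?_)
    have h2 : conj (2 : ℂ) = 2 := Complex.conj_ofNat 2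
    simp only [map_mul, hconj, ← Complex.exp_conj, h2, Complex.conj_ofReal, Complex.conj_I]
    congr 2
    push_cast
    ring

theorem eLpNorm_one_ne_top (G : 𝓢(ℝ, ℂ)) : eLpNorm G 1 volume ≠ ∞ :=
  (memLp_one_iff_integrable.2 G.integrable).2.ne

/-- Affine rescaling preserves the norm of `𝓕L¹`. -/
theorem exists_rescale (χ : 𝓢(ℝ, ℂ)) (b : ℝ) {h : ℝ} (hh : 0 < h) :
    ∃ X : 𝓢(ℝ, ℂ), (∀ ξ, X ξ = χ ((ξ - b) / h)) ∧
      eLpNorm (𝓕⁻ X : 𝓢(ℝ, ℂ)) 1 volume = eLpNorm (𝓕⁻ χ : 𝓢(ℝ, ℂ)) 1 volume := by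
  have hcancel : h ^ (1 / 2 : ℝ) * h⁻¹ ^ (1 / 2 : ℝ) = 1 := by
    rw [← Real.mul_rpow hh.le (by positivity), mul_inv_cancel₀ hh.ne', Real.one_rpow]
  refine ⟨((h ^ (1 / 2 : ℝ) : ℝ) : ℂ) • freqWindow h⁻¹ (inv_pos.2 hh) b (𝓕⁻ χ), fun ξ => ?_, ?_⟩
  · rw [_root_.smul_apply, freqWindow_apply, smul_eq_mul, ← mul_assoc, ← Complex.ofReal_mul,
      hcancel, Complex.ofReal_one, one_mul, FourierTransform.fourier_fourierInv_eq]
    congr 1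
    field_simp
  · rw [FourierTransform.fourierInv_smul]
    have : (((h ^ (1 / 2 : ℝ) : ℝ) : ℂ) • 𝓕⁻ (freqWindow h⁻¹ (inv_pos.2 hh) b (𝓕⁻ χ)) : ℝ → ℂ) =
      (((h ^ (1 / 2 : ℝ) : ℝ) : ℂ) •
        (𝓕⁻ (freqWindow h⁻¹ (inv_pos.2 hh) b (𝓕⁻ χ)) : 𝓢(ℝ, ℂ)) : 𝓢(ℝ, ℂ)) := rfl
    rw [← this, eLpNorm_const_smul, eLpNorm_one_fourierInv_freqWindow, ← mul_assoc]
    have e : ‖((h ^ (1 / 2 : ℝ) : ℝ) : ℂ)‖ₑ = ENNReal.ofReal (h ^ (1 / 2 : ℝ)) := by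
      rw [← ofReal_norm, Complex.norm_real, Real.norm_of_nonneg (by positivity)]
    rw [e, ← ENNReal.ofReal_mul (by positivity), hcancel, ENNReal.ofReal_one, one_mul]

theorem abs_scale_mul (α c ω ξ : ℝ) (hc : 0 < c) :
    |c * (1 + |ω|) ^ (-α) * (ξ - ω)| = c * (|ξ - ω| / (1 + |ω|) ^ α) := by
  rw [abs_mul, abs_of_pos (scale_pos hc α ω), Real.rpow_neg (by positivity)]
  ring

theorem sqrt_scale (α c ω : ℝ) (hc : 0 < c) :
    (c * (1 + |ω|) ^ (-α)) ^ (1 / 2 : ℝ) = c ^ (1 / 2 : ℝ) * (1 + |ω|) ^ (-(α / 2)) := by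
  rw [Real.mul_rpow hc.le (by positivity), ← Real.rpow_mul (by positivity)]
  congr 2; ring

/-! ### Comparison of segments and α-transform at single frequencies -/

section Window

variable {α c : ℝ} {hc : 0 < c} {g : 𝓢(ℝ, ℂ)}

theorem freqWindow_eq_zero (hg0 : ∀ ξ, c / 2 ≤ |ξ| → (𝓕 g : 𝓢(ℝ, ℂ)) ξ = 0) {x ξ : ℝ}
    (h : 1 / 2 * (1 + |x|) ^ α ≤ |ξ - x|) :
    freqWindow (c * (1 + |x|) ^ (-α)) (scale_pos hc α x) x g ξ = 0 := by
  rw [freqWindow_apply, hg0, mul_zero]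
  rw [abs_scale_mul _ _ _ _ hc, div_eq_mul_one_div]
  exact mul_le_mul_of_nonneg_left ((le_div_iff₀ (by positivity)).2 h) hc.le

theorem freqWindow_eq_const (hg1 : ∀ ξ, |ξ| ≤ c / 4 → (𝓕 g : 𝓢(ℝ, ℂ)) ξ = 1) {x ξ : ℝ}
    (h : |ξ - x| ≤ 1 / 4 * (1 + |x|) ^ α) :
    freqWindow (c * (1 + |x|) ^ (-α)) (scale_pos hc α x) x g ξ =
      (((c * (1 + |x|) ^ (-α)) ^ (1 / 2 : ℝ) : ℝ) : ℂ) := by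
  rw [freqWindow_apply, hg1, mul_one]
  rw [abs_scale_mul _ _ _ _ hc, div_eq_mul_one_div c 4]
  exact mul_le_mul_of_nonneg_left ((div_le_iff₀ (by positivity)).2 h) hc.le

variable {𝓘 : Set (Set ℝ)} {ψ : 𝓘 → 𝓢(ℝ, ℂ)} {ω : 𝓘 → ℝ} {p : ℝ≥0∞}

/-- At each frequency the α-transform is controlled by a single nearby segment. -/
theorem exists_segment_bound (hα : α ∈ Set.Icc (0 : ℝ) 1) (hp : 1 ≤ p)
    (hg0 : ∀ ξ, c / 2 ≤ |ξ| → (𝓕 g : 𝓢(ℝ, ℂ)) ξ = 0)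
    (h𝓘 : IsAlphaCovering α 𝓘) (hψ : IsBAPU 𝓘 ψ) (hω : ∀ I : 𝓘, ω I ∈ (I : Set ℝ)) :
    ∃ (R : ℝ) (C : ℝ≥0∞), 0 ≤ R ∧ C ≠ ∞ ∧ ∀ (f : 𝓢'(ℝ, ℂ)) (x : ℝ), ∃ I : 𝓘,
      Near α R x (ω I) ∧
      eLpNorm (segmentFun (freqWindow (c * (1 + |x|) ^ (-α)) (scale_pos hc α x) x g) f) p volume ≤
        C * ENNReal.ofReal ((1 + |x|) ^ (-(α / 2))) *
          eLpNorm (segmentFun (ψ I) f) p volume := by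
  classical
  obtain ⟨A, B, hA, hB, hsize⟩ := h𝓘.size
  have hR : 0 ≤ 1 + B + 1 * B := by positivity
  obtain ⟨N, hN⟩ := h𝓘.exists_card_near_le hα hω hR
  refine ⟨1 + B + 1 * B, N * ENNReal.ofReal (c ^ (1 / 2 : ℝ)) * eLpNorm g 1 volume, hR,
    ENNReal.mul_ne_top (ENNReal.mul_ne_top (ENNReal.natCast_ne_top N) ENNReal.ofReal_ne_top)
      (eLpNorm_one_ne_top g), fun f x => ?_⟩
  set Ψ := freqWindow (c * (1 + |x|) ^ (-α)) (scale_pos hc α x) x g with hΨ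
  -- Only these intervals can meet the support of the window at `x`.
  let S : Set 𝓘 := {I | ∃ ξ ∈ (I : Set ℝ), |ξ - x| ≤ 1 / 2 * (1 + |x|) ^ α}
  have hnear : ∀ I ∈ S, Near α (1 + B + 1 * B) x (ω I) := by
    rintro I ⟨ξ, hξ, hξx⟩
    have h1 : Near α 1 ξ x := by simpa using Near.of_le hα le_rfl hξx
    exact h1.symm.trans hα zero_le_one hB.le (near_of_mem hB.le (h𝓘.interval I I.2)
      (fun ξ hξ => (hsize I I.2 ξ hξ).2) hξ (hω I))
  have hfin : S.Finite := by
    by_contra hinf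
    obtain ⟨t, ht, hcard⟩ := Set.Infinite.exists_subset_card_eq hinf (N + 1)
    have := hN x t fun I hI => hnear I (ht hI)
    omega
  let T := hfin.toFinset
  have hT : ∀ I, I ∈ T ↔ I ∈ S := fun I => hfin.mem_toFinset
  have hne : T.Nonempty := by
    obtain ⟨I, hI, hxI⟩ : x ∈ ⋃₀ 𝓘 := h𝓘.covers ▸ Set.mem_univ x
    exact ⟨⟨I, hI⟩, (hT _).2 ⟨x, hxI, by rw [sub_self, abs_zero]; positivity⟩⟩
  have hdecomp : Ψ = ∑ I ∈ T, mulSchwartz Ψ (ψ I) := by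
    ext ξ
    rw [_root_.sum_apply]
    simp only [mulSchwartz_apply]
    rw [← Finset.mul_sum]
    by_cases h : |ξ - x| ≤ 1 / 2 * (1 + |x|) ^ α
    · have h1 : HasSum (fun I : 𝓘 => ψ I ξ) (∑ I ∈ T, ψ I ξ) := by
        refine hasSum_sum_of_ne_finset_zero fun I hI => ?_
        refine image_eq_zero_of_notMem_tsupport fun hmem => hI ?_
        exact (hT I).2 ⟨ξ, hψ.supp I hmem, h⟩
      rw [h1.unique (hψ.sum_eq_one ξ), mul_one]
    · rw [freqWindow_eq_zero (hc := hc) hg0 (not_le.1 h).le, zero_mul]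
  -- Keeping the largest term instead of the sum leaves one coefficient per frequency, as
  -- `eLpNorm_le_lqNorm` requires.
  obtain ⟨I, hI, hmax⟩ := T.exists_max_image
    (fun I => eLpNorm (segmentFun (ψ I) f) p volume) hne
  refine ⟨I, hnear I ((hT I).1 hI), ?_⟩
  have hK : eLpNorm (𝓕⁻ Ψ : 𝓢(ℝ, ℂ)) 1 volume = ENNReal.ofReal (c ^ (1 / 2 : ℝ)) *
      ENNReal.ofReal ((1 + |x|) ^ (-(α / 2))) * eLpNorm g 1 volume := by
    rw [hΨ, eLpNorm_one_fourierInv_freqWindow, sqrt_scale _ _ _ hc,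
      ENNReal.ofReal_mul (by positivity)]
  have hcard : T.card ≤ N := hN x T fun I hI => hnear I ((hT I).1 hI)
  calc eLpNorm (segmentFun Ψ f) p volume
      = eLpNorm (segmentFun (∑ I ∈ T, mulSchwartz Ψ (ψ I)) f) p volume := by rw [← hdecomp]
    _ ≤ ∑ I ∈ T, eLpNorm (segmentFun (mulSchwartz Ψ (ψ I)) f) p volume :=
        eLpNorm_segmentFun_sum_le hp T _ f
    _ ≤ ∑ _I ∈ T, eLpNorm (𝓕⁻ Ψ : 𝓢(ℝ, ℂ)) 1 volume *
          eLpNorm (segmentFun (ψ I) f) p volume := by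
        refine Finset.sum_le_sum fun I' hI' => ?_
        exact (eLpNorm_segmentFun_mulSchwartz_le hp Ψ (ψ I') f).trans
          (mul_le_mul' le_rfl (hmax I' hI'))
    _ = T.card * (eLpNorm (𝓕⁻ Ψ : 𝓢(ℝ, ℂ)) 1 volume *
          eLpNorm (segmentFun (ψ I) f) p volume) := by
        rw [Finset.sum_const, nsmul_eq_mul]
    _ ≤ N * (eLpNorm (𝓕⁻ Ψ : 𝓢(ℝ, ℂ)) 1 volume *
          eLpNorm (segmentFun (ψ I) f) p volume) := by gcongr
    _ = _ := by rw [hK]; ring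

/-- Each segment is controlled by the α-transform at all frequencies of an interval of comparable
length. -/
theorem exists_interval_bound (hα : α ∈ Set.Icc (0 : ℝ) 1) (hp : 1 ≤ p)
    (hg1 : ∀ ξ, |ξ| ≤ c / 4 → (𝓕 g : 𝓢(ℝ, ℂ)) ξ = 1)
    (h𝓘 : IsAlphaCovering α 𝓘) (hψ : IsBAPU 𝓘 ψ) (hω : ∀ I : 𝓘, ω I ∈ (I : Set ℝ)) :
    ∃ (R δ : ℝ) (C : ℝ≥0∞), 0 ≤ R ∧ 0 < δ ∧ C ≠ ∞ ∧ ∀ (f : 𝓢'(ℝ, ℂ)) (I : 𝓘), ∃ J : Set ℝ,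
      MeasurableSet J ∧ volume J = ENNReal.ofReal (δ * (1 + |ω I|) ^ α) ∧
      ∀ x ∈ J, Near α R x (ω I) ∧ eLpNorm (segmentFun (ψ I) f) p volume ≤
        C * ENNReal.ofReal ((1 + |x|) ^ (α / 2)) * eLpNorm (segmentFun
          (freqWindow (c * (1 + |x|) ^ (-α)) (scale_pos hc α x) x g) f) p volume := by
  classical
  obtain ⟨A, B, hA, hB, hsize⟩ := h𝓘.size
  obtain ⟨Cψ, hCψ⟩ := hψ.bounded
  obtain ⟨χ, hχ0, hχ1⟩ := exists_translation_partition
  -- Chosen so that balls of radius `h = δ(1+|ω I|)^α` have diameter at most `1/8` of the scale at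
  -- any point of `I`, well inside the flat part of a window. With `M ≥ B/δ`, the `2M+1` bumps
  -- spaced by `h` sum to `1` on `I`.
  set δ : ℝ := 1 / (16 * (1 + B)) with hδ
  have hδ0 : 0 < δ := by positivity
  obtain ⟨M, hM⟩ := exists_nat_ge (B / δ)
  refine ⟨1 / 4 + B + 1 / 4 * B, 2 * δ, (2 * M + 1 : ℕ) * (ENNReal.ofReal (c ^ (-(1 / 2) : ℝ)) *
    (eLpNorm (𝓕⁻ χ : 𝓢(ℝ, ℂ)) 1 volume * Cψ)), by positivity, by positivity,
    ENNReal.mul_ne_top (ENNReal.natCast_ne_top _) (ENNReal.mul_ne_top ENNReal.ofReal_ne_top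
      (ENNReal.mul_ne_top (eLpNorm_one_ne_top _) ENNReal.coe_ne_top)),
    fun f I => ?_⟩
  set h : ℝ := δ * (1 + |ω I|) ^ α with hh
  have hh0 : 0 < h := by positivity
  have hnearI : ∀ ξ ∈ (I : Set ℝ), Near α B (ω I) ξ := fun ξ hξ =>
    near_of_mem hB.le (h𝓘.interval I I.2) (fun ξ hξ => (hsize I I.2 ξ hξ).2) (hω I) hξ
  let b : ℕ → ℝ := fun j => ω I + h * ((j : ℝ) - M)
  choose X hX hXn using fun j => exists_rescale χ (b j) hh0
  have hX0 : ∀ j ξ, h ≤ |ξ - b j| → X j ξ = 0 := by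
    intro j ξ hξ
    rw [hX, hχ0]
    rw [abs_div, abs_of_pos hh0]
    exact (one_le_div hh0).2 hξ
  let J : ℕ → Set ℝ := fun j => Metric.closedBall (b j) h
  let T := (Finset.range (2 * M + 1)).filter fun j => (J j ∩ I).Nonempty
  have hne : T.Nonempty := by
    refine ⟨M, Finset.mem_filter.2 ⟨Finset.mem_range.2 (by omega), ω I, ?_, hω I⟩⟩
    simp only [J, b, sub_self, mul_zero, add_zero]
    exact Metric.mem_closedBall_self hh0.le
  have hdecomp : ψ I = ∑ j ∈ T, mulSchwartz (X j) (ψ I) := by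
    ext ξ
    rw [_root_.sum_apply]
    simp only [mulSchwartz_apply]
    rw [← Finset.sum_mul]
    by_cases hξ : ξ ∈ (I : Set ℝ)
    · have h1 : ∑ j ∈ T, X j ξ = ∑ j ∈ Finset.range (2 * M + 1), X j ξ := by
        refine Finset.sum_subset (Finset.filter_subset _ _) fun j hj hjT => ?_
        refine hX0 j ξ ?_
        by_contra hcon
        refine hjT (Finset.mem_filter.2 ⟨hj, ξ, ?_, hξ⟩)
        rw [Metric.mem_closedBall, Real.dist_eq]
        exact (not_le.1 hcon).le
      have h2 : |(ξ - ω I) / h| ≤ M := by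
        rw [abs_div, abs_of_pos hh0, div_le_iff₀ hh0, abs_sub_comm]
        refine (hnearI ξ hξ).1.trans ?_
        rw [hh, ← mul_assoc]
        gcongr
        exact (div_le_iff₀ hδ0).1 hM
      have h3 := hχ1 M _ h2
      rw [h1]
      have h4 : ∀ j : ℕ, X j ξ = χ ((ξ - ω I) / h - ((j : ℝ) - M)) := by
        intro j
        rw [hX]
        congr 1
        simp only [b]
        field_simp
        ring
      simp only [h4, h3, one_mul]
    · rw [image_eq_zero_of_notMem_tsupport fun hmem => hξ (hψ.supp I hmem), mul_zero]
  -- The largest piece bounds the whole segment up to the factor `2M+1`. Its index, and so the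
  -- interval, depends on `f`, but the constants do not.
  obtain ⟨j, hj, hmax⟩ := T.exists_max_image
    (fun j => eLpNorm (segmentFun (mulSchwartz (X j) (ψ I)) f) p volume) hne
  refine ⟨J j, Metric.isClosed_closedBall.measurableSet, ?_, fun x hx => ?_⟩
  · rw [Real.volume_closedBall, hh, mul_assoc]
  obtain ⟨ξ₀, hξ₀J, hξ₀I⟩ := (Finset.mem_filter.1 hj).2
  rw [Metric.mem_closedBall, Real.dist_eq] at hx hξ₀J
  have hscale : 2 * h ≤ 1 / 8 * (1 + |ξ₀|) ^ α := by
    have h1 := mul_le_mul_of_nonneg_left ((hnearI ξ₀ hξ₀I).scale_le hα hB.le)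
      (by positivity : 0 ≤ 2 * δ)
    have h2 : 2 * δ * ((1 + B) * (1 + |ξ₀|) ^ α) = 1 / 8 * (1 + |ξ₀|) ^ α := by
      rw [hδ]; field_simp; norm_num
    rw [h2] at h1
    rw [hh]; linarith
  have hx0 : |x - ξ₀| ≤ 1 / 8 * (1 + |ξ₀|) ^ α := by
    have h1 : |x - ξ₀| ≤ |x - b j| + |b j - ξ₀| := abs_sub_le _ _ _
    rw [abs_sub_comm (b j)] at h1
    linarith
  have hnx : Near α (1 / 4) x ξ₀ := by
    have := Near.of_le hα (by norm_num) hx0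
    norm_num at this ⊢
    exact this
  refine ⟨hnx.trans hα (by norm_num) hB.le (hnearI ξ₀ hξ₀I).symm, ?_⟩
  set Ψ := freqWindow (c * (1 + |x|) ^ (-α)) (scale_pos hc α x) x g with hΨ
  set a := (c * (1 + |x|) ^ (-α)) ^ (1 / 2 : ℝ) with ha
  have ha0 : 0 < a := Real.rpow_pos_of_pos (scale_pos hc α x) _
  -- On the set where `X j` can be nonzero the window at `x` is the constant `a`, so it may be
  -- inserted and divided out.
  have hfac : mulSchwartz (X j) (ψ I) =
      ((a⁻¹ : ℝ) : ℂ) • mulSchwartz (X j) (mulSchwartz (ψ I) Ψ) := by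
    ext ξ
    simp only [_root_.smul_apply, mulSchwartz_apply, smul_eq_mul]
    by_cases hξ : h ≤ |ξ - b j|
    · rw [hX0 j ξ hξ]; simp
    · have h1 : |ξ - x| ≤ 1 / 4 * (1 + |x|) ^ α := by
        have h2 : |ξ - x| ≤ |ξ - b j| + |b j - x| := abs_sub_le _ _ _
        rw [abs_sub_comm (b j)] at h2
        have h3 := hnx.symm.scale_le hα (by norm_num)
        have h4 : 0 < (1 + |x|) ^ α := by positivity
        linarith [not_le.1 hξ]
      rw [hΨ, freqWindow_eq_const (hc := hc) hg1 h1, ← ha]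
      have : (a : ℂ) ≠ 0 := by exact_mod_cast ha0.ne'
      push_cast
      field_simp
  have hinv : ‖((a⁻¹ : ℝ) : ℂ)‖ₑ = ENNReal.ofReal (c ^ (-(1 / 2) : ℝ)) *
      ENNReal.ofReal ((1 + |x|) ^ (α / 2)) := by
    rw [← ofReal_norm, Complex.norm_real, Real.norm_of_nonneg (by positivity),
      ← ENNReal.ofReal_mul (by positivity), ha, sqrt_scale _ _ _ hc, mul_inv,
      ← Real.rpow_neg hc.le, ← Real.rpow_neg (by positivity), neg_neg]
  set v := eLpNorm (segmentFun Ψ f) p volume with hv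
  have hpiece : eLpNorm (segmentFun (mulSchwartz (X j) (ψ I)) f) p volume ≤
      ENNReal.ofReal (c ^ (-(1 / 2) : ℝ)) * ENNReal.ofReal ((1 + |x|) ^ (α / 2)) *
        (eLpNorm (𝓕⁻ χ : 𝓢(ℝ, ℂ)) 1 volume * (Cψ * v)) := by
    rw [hfac, eLpNorm_segmentFun_smul, hinv]
    refine mul_le_mul' le_rfl ?_
    refine (eLpNorm_segmentFun_mulSchwartz_le hp _ _ f).trans ?_
    rw [hXn]
    refine mul_le_mul' le_rfl ?_
    exact (eLpNorm_segmentFun_mulSchwartz_le hp _ _ f).trans (mul_le_mul' (hCψ I) le_rfl)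
  calc eLpNorm (segmentFun (ψ I) f) p volume
      = eLpNorm (segmentFun (∑ j ∈ T, mulSchwartz (X j) (ψ I)) f) p volume := by rw [← hdecomp]
    _ ≤ ∑ j ∈ T, eLpNorm (segmentFun (mulSchwartz (X j) (ψ I)) f) p volume :=
        eLpNorm_segmentFun_sum_le hp T _ f
    _ ≤ T.card • eLpNorm (segmentFun (mulSchwartz (X j) (ψ I)) f) p volume :=
        Finset.sum_le_card_nsmul _ _ _ hmax
    _ ≤ (2 * M + 1 : ℕ) * eLpNorm (segmentFun (mulSchwartz (X j) (ψ I)) f) p volume := by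
        rw [nsmul_eq_mul]
        gcongr
        exact (Finset.card_filter_le _ _).trans_eq (Finset.card_range _)
    _ ≤ _ := mul_le_mul' le_rfl hpiece
    _ = _ := by ring

end Window

/-! ### Equivalence of the norms -/

theorem mixedNorm_alphaTransform {α c : ℝ} {hc : 0 < c} {g : 𝓢(ℝ, ℂ)}
    (hg : ∀ t, conj (g t) = g (-t)) (p q : ℝ≥0∞) (s : ℝ) (f : 𝓢'(ℝ, ℂ)) :
    mixedNorm p q (freqWeight s) (alphaTransform α c hc g f) =
      eLpNorm (fun x : ℝ => ENNReal.ofReal ((1 + |x|) ^ s) * eLpNorm (segmentFun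
        (freqWindow (c * (1 + |x|) ^ (-α)) (scale_pos hc α x) x g) f) p volume) q volume := by
  rw [mixedNorm]
  congr 1
  funext x
  have h1 : (fun t : ℝ => (freqWeight s (t, x) : ℂ) * alphaTransform α c hc g f (t, x)) =
      (((1 + |x|) ^ s : ℝ) : ℂ) •
        segmentFun (freqWindow (c * (1 + |x|) ^ (-α)) (scale_pos hc α x) x g) f := by
    funext t
    rw [alphaTransform_eq_segmentFun α c hc hg]
    rfl
  rw [h1, eLpNorm_const_smul, ← ofReal_norm, Complex.norm_real,
    Real.norm_of_nonneg (by positivity)]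

/-- The exponent splits as `(s - α/2) + α/q`, isolating the factor comparable to `|I|^{1/q}` in the
form that the `L^q`–`ℓ^q` comparisons use. -/
theorem modNorm_eq {p : ℝ≥0∞} (hp : 1 ≤ p) (q : ℝ≥0∞) (𝓘 : Set (Set ℝ)) (ψ : 𝓘 → 𝓢(ℝ, ℂ))
    (ω : 𝓘 → ℝ) (s α : ℝ) (f : 𝓢'(ℝ, ℂ)) :
    modNorm 𝓘 ψ ω p q (s + α * ((q⁻¹).toReal - 1 / 2)) f =
      lqNorm q fun I : 𝓘 => eLpNorm (segmentFun (ψ I) f) p volume *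
        ENNReal.ofReal ((1 + |ω I|) ^ (s - α / 2)) *
          ENNReal.ofReal ((1 + |ω I|) ^ α) ^ (q⁻¹).toReal := by
  rw [modNorm]
  congr 1
  funext I
  rw [distLpNorm_segmentation hp, mul_assoc,
    ENNReal.ofReal_rpow_of_nonneg (by positivity) ENNReal.toReal_nonneg,
    ← ENNReal.ofReal_mul (by positivity), ← Real.rpow_mul (by positivity),
    ← Real.rpow_add (by positivity)]
  congr 3
  ring

theorem ofReal_rpow_mul_ofReal_rpow (x a b : ℝ) :
    ENNReal.ofReal ((1 + |x|) ^ a) * ENNReal.ofReal ((1 + |x|) ^ b) =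
      ENNReal.ofReal ((1 + |x|) ^ (a + b)) := by
  rw [← ENNReal.ofReal_mul (by positivity), ← Real.rpow_add (by positivity)]

theorem Near.ofReal_rpow_le {α R x y : ℝ} (hα : α ∈ Set.Icc (0 : ℝ) 1) (hR : 0 ≤ R)
    (h : Near α R x y) (r : ℝ) :
    ENNReal.ofReal ((1 + |x|) ^ r) ≤
      ENNReal.ofReal ((1 + R) ^ |r|) * ENNReal.ofReal ((1 + |y|) ^ r) := by
  rw [← ENNReal.ofReal_mul (by positivity)]
  exact ENNReal.ofReal_le_ofReal (h.rpow_le hα hR r)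

section Equivalence

variable {α c : ℝ} {hc : 0 < c} {g : 𝓢(ℝ, ℂ)} {𝓘 : Set (Set ℝ)} {ψ : 𝓘 → 𝓢(ℝ, ℂ)} {ω : 𝓘 → ℝ}
  {p q : ℝ≥0∞}

theorem exists_mixedNorm_le_modNorm (s : ℝ) (hα : α ∈ Set.Icc (0 : ℝ) 1) (hp : 1 ≤ p)
    (hq : 1 ≤ q) (hg : ∀ t, conj (g t) = g (-t))
    (hg0 : ∀ ξ, c / 2 ≤ |ξ| → (𝓕 g : 𝓢(ℝ, ℂ)) ξ = 0)
    (h𝓘 : IsAlphaCovering α 𝓘) (hψ : IsBAPU 𝓘 ψ) (hω : ∀ I : 𝓘, ω I ∈ (I : Set ℝ)) :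
    ∃ C : ℝ≥0∞, C ≠ ∞ ∧ ∀ f : 𝓢'(ℝ, ℂ),
      mixedNorm p q (freqWeight s) (alphaTransform α c hc g f) ≤
        C * modNorm 𝓘 ψ ω p q (s + α * ((q⁻¹).toReal - 1 / 2)) f := by
  obtain ⟨R, C, hR, hC, hbound⟩ := exists_segment_bound (hc := hc) hα hp hg0 h𝓘 hψ hω
  have : Countable 𝓘 := h𝓘.countable
  refine ⟨C * ENNReal.ofReal ((1 + R) ^ |s - α / 2|) * ENNReal.ofReal (2 * R) ^ (q⁻¹).toReal,
    ENNReal.mul_ne_top (ENNReal.mul_ne_top hC ENNReal.ofReal_ne_top)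
      (ENNReal.rpow_ne_top_of_nonneg ENNReal.toReal_nonneg ENNReal.ofReal_ne_top), fun f => ?_⟩
  rw [mixedNorm_alphaTransform hg, modNorm_eq hp]
  refine eLpNorm_le_lqNorm hq (U := fun I => {x | Near α R x (ω I)})
    (fun I => measurableSet_near α R (ω I)) (fun I => ?_) fun x => ?_
  · rw [← ENNReal.ofReal_mul (by positivity)]
    exact volume_near_le α R (ω I)
  · obtain ⟨I, hI, hle⟩ := hbound f x
    refine ⟨I, hI, ?_⟩
    calc _ ≤ ENNReal.ofReal ((1 + |x|) ^ s) * (C * ENNReal.ofReal ((1 + |x|) ^ (-(α / 2))) *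
          eLpNorm (segmentFun (ψ I) f) p volume) := mul_le_mul' le_rfl hle
      _ = C * ENNReal.ofReal ((1 + |x|) ^ (s - α / 2)) *
          eLpNorm (segmentFun (ψ I) f) p volume := by
          rw [sub_eq_add_neg, ← ofReal_rpow_mul_ofReal_rpow]; ring
      _ ≤ C * (ENNReal.ofReal ((1 + R) ^ |s - α / 2|) *
          ENNReal.ofReal ((1 + |ω I|) ^ (s - α / 2))) *
          eLpNorm (segmentFun (ψ I) f) p volume := by
          gcongr
          exact hI.ofReal_rpow_le hα hR _
      _ = _ := by ring

theorem exists_modNorm_le_mixedNorm (s : ℝ) (hα : α ∈ Set.Icc (0 : ℝ) 1) (hp : 1 ≤ p)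
    (hq : 1 ≤ q) (hg : ∀ t, conj (g t) = g (-t))
    (hg1 : ∀ ξ, |ξ| ≤ c / 4 → (𝓕 g : 𝓢(ℝ, ℂ)) ξ = 1)
    (h𝓘 : IsAlphaCovering α 𝓘) (hψ : IsBAPU 𝓘 ψ) (hω : ∀ I : 𝓘, ω I ∈ (I : Set ℝ)) :
    ∃ C : ℝ≥0∞, C ≠ ∞ ∧ ∀ f : 𝓢'(ℝ, ℂ),
      modNorm 𝓘 ψ ω p q (s + α * ((q⁻¹).toReal - 1 / 2)) f ≤
        C * mixedNorm p q (freqWeight s) (alphaTransform α c hc g f) := by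
  obtain ⟨R, δ, C, hR, hδ, hC, hbound⟩ := exists_interval_bound (hc := hc) hα hp hg1 h𝓘 hψ hω
  obtain ⟨N, hN⟩ := h𝓘.exists_card_near_le hα hω hR
  lift C to ℝ≥0 using hC
  refine ⟨(C * Real.toNNReal ((1 + R) ^ |s - α / 2|) : ℝ≥0) *
    (ENNReal.ofReal δ⁻¹ * N) ^ (q⁻¹).toReal, ENNReal.mul_ne_top ENNReal.coe_ne_top
      (ENNReal.rpow_ne_top_of_nonneg ENNReal.toReal_nonneg
        (ENNReal.mul_ne_top ENNReal.ofReal_ne_top (ENNReal.natCast_ne_top N))), fun f => ?_⟩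
  rw [mixedNorm_alphaTransform hg, modNorm_eq hp]
  -- These sets depend on `f`, but every point of `J I` is near `ω I`, so their overlap is at most
  -- the uniform `N`.
  choose J hJm hJv hJ using hbound f
  refine lqNorm_le_eLpNorm hq hJm (fun I => ?_) (fun I => ?_) (fun I x hx => ?_)
    fun x t ht => hN x t fun I hI => (hJ I x (ht I hI)).1
  · rw [hJv]
    exact (ENNReal.ofReal_pos.2 (by positivity)).ne'
  · rw [hJv, ← ENNReal.ofReal_mul (by positivity), inv_mul_cancel_left₀ hδ.ne']
  · obtain ⟨hI, hle⟩ := hJ I x hx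
    set v := eLpNorm (segmentFun
      (freqWindow (c * (1 + |x|) ^ (-α)) (scale_pos hc α x) x g) f) p volume
    rw [ENNReal.coe_mul]
    change _ ≤ (C : ℝ≥0∞) * ENNReal.ofReal ((1 + R) ^ |s - α / 2|) *
      (ENNReal.ofReal ((1 + |x|) ^ s) * v)
    calc _ ≤ (C * ENNReal.ofReal ((1 + |x|) ^ (α / 2)) * v) *
          (ENNReal.ofReal ((1 + R) ^ |s - α / 2|) *
            ENNReal.ofReal ((1 + |x|) ^ (s - α / 2))) :=
          mul_le_mul' hle (hI.symm.ofReal_rpow_le hα hR _)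
      _ = C * ENNReal.ofReal ((1 + R) ^ |s - α / 2|) *
          (ENNReal.ofReal ((1 + |x|) ^ (s - α / 2)) * ENNReal.ofReal ((1 + |x|) ^ (α / 2)) *
            v) := by ring
      _ = _ := by rw [ofReal_rpow_mul_ofReal_rpow, sub_add_cancel]

end Equivalence

end AlphaMod

end

theorem mainTheorem5 (s α c : ℝ) (hα : α ∈ Set.Icc (0 : ℝ) 1) (hc : 0 < c)
    (p q : ℝ≥0∞) (hp : 1 ≤ p) (hq : 1 ≤ q) :
    ∃ g : 𝓢(ℝ, ℂ), g ≠ 0 ∧ AlphaMod.IsBandLimited g ∧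
      ∀ (𝓘 : Set (Set ℝ)) (ψ : 𝓘 → 𝓢(ℝ, ℂ)) (ω : 𝓘 → ℝ),
        AlphaMod.IsAlphaCovering α 𝓘 → AlphaMod.IsBAPU 𝓘 ψ → (∀ I : 𝓘, ω I ∈ (I : Set ℝ)) →
          AlphaMod.modSpace 𝓘 ψ ω p q (s + α * ((q⁻¹).toReal - 1 / 2)) =
              {f : 𝓢'(ℝ, ℂ) | AlphaMod.MemMixed p q (AlphaMod.freqWeight s)
                (AlphaMod.alphaTransform α c hc g f)} ∧
            ∃ A B : ℝ≥0, 0 < A ∧ 0 < B ∧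
              ∀ f ∈ AlphaMod.modSpace 𝓘 ψ ω p q (s + α * ((q⁻¹).toReal - 1 / 2)),
                A * AlphaMod.mixedNorm p q (AlphaMod.freqWeight s)
                      (AlphaMod.alphaTransform α c hc g f) ≤
                    AlphaMod.modNorm 𝓘 ψ ω p q (s + α * ((q⁻¹).toReal - 1 / 2)) f ∧
                  AlphaMod.modNorm 𝓘 ψ ω p q (s + α * ((q⁻¹).toReal - 1 / 2)) f ≤
                    B * AlphaMod.mixedNorm p q (AlphaMod.freqWeight s)
                      (AlphaMod.alphaTransform α c hc g f) := by
  obtain ⟨g, hgne, hgband, hg, hg1, hg0⟩ := AlphaMod.exists_window hc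
  refine ⟨g, hgne, hgband, fun 𝓘 ψ ω h𝓘 hψ hω => ?_⟩
  obtain ⟨C₁, hC₁, h₁⟩ := AlphaMod.exists_mixedNorm_le_modNorm (hc := hc) s hα hp hq hg hg0
    h𝓘 hψ hω
  obtain ⟨C₂, hC₂, h₂⟩ := AlphaMod.exists_modNorm_le_mixedNorm (hc := hc) s hα hp hq hg hg1
    h𝓘 hψ hω
  lift C₁ to ℝ≥0 using hC₁
  lift C₂ to ℝ≥0 using hC₂
  -- Both estimates hold for all tempered `f`, so they also give the equality of the spaces. Adding
  -- `1` keeps the constants positive.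
  refine ⟨Set.ext fun f => ⟨fun hf => ⟨?_, ?_⟩, fun hf => ?_⟩, (C₁ + 1)⁻¹, C₂ + 1, by positivity,
    by positivity, fun f _ => ⟨?_, (h₂ f).trans ?_⟩⟩
  · exact (AlphaMod.stronglyMeasurable_alphaTransform α c hc hg hg0 f).aestronglyMeasurable
  · exact (h₁ f).trans_lt (ENNReal.mul_lt_top ENNReal.coe_lt_top hf)
  · exact (h₂ f).trans_lt (ENNReal.mul_lt_top ENNReal.coe_lt_top hf.2)
  · have hne : ((C₁ + 1 : ℝ≥0) : ℝ≥0∞) ≠ 0 := by simp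
    rw [ENNReal.coe_inv (by positivity),
      ENNReal.inv_mul_le_iff hne ENNReal.coe_ne_top]
    refine (h₁ f).trans ?_
    gcongr
    exact le_self_add
  · gcongr
    exact le_self_add
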